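/- Let $\mathbb{T}$ be the unit circle. A function $\omega:(0,\pi]\to[0,\infty)$ belongs to the Bari--Stechkin class if it is measurable and almost increasing (there is $A>0$ with $\omega(x)\le A\,\omega(y)$ whenever $0<x\le y\le\pi$), $\omega(x)>0$ for all $x\in(0,\pi]$, $\lim_{x\to0+}\omega(x)=0$, and \[ \sup_{0<x\le\pi}\frac{1}{\omega(x)}\int_0^x\frac{\omega(y)}{y}\,dy<\infty, \qquad \sup_{0<x\le\pi}\frac{x}{\omega(x)}\int_x^\pi\frac{\omega(y)}{y^2}\,dy<\infty . \] For continuous $f:\mathbb{T}\to\mathbb{C}$ put $\omega(f,x):=\sup_{|h|\le x}\sup_{y\in\mathbb{R}}|f(e^{i(y+h)})-f(e^{iy})|$ and $|f|_\omega:=\sup_{0<x\le\pi}\omega(f,x)/\omega(x)$. Let $\mathcal{H}^\omega$ be the algebra (under pointwise operations) of all continuous $f:\mathbb{T}\to\mathbb{C}$ with $|f|_\omega<\infty$, normed by $\|f\|_{\mathcal{H}^\omega}:=\max_{\mathbb{T}}|f|+|f|_\omega$, and let $\mathcal{H}_0^\omega$ be its subalgebra, with the same norm, of those $f\in\mathcal{H}^\omega$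 for which $\lim_{x\to0+}\omega(f,x)/\omega(x)=0$. Let $S$ be the Cauchy singular integral operator \[ (S\varphi)(t):=\frac{1}{\pi i}\,\mathrm{v.p.}\int_{\mathbb{T}}\frac{\varphi(\tau)}{\tau-t}\,d\tau =\lim_{\varepsilon\to0+}\frac{1}{\pi i}\int_{\{\tau\in\mathbb{T}:\,|\tau-t|>\varepsilon\}}\frac{\varphi(\tau)}{\tau-t}\,d\tau \qquad(t\in\mathbb{T}), \] where $\mathbb{T}$ is oriented counterclockwise. **Theorem.** Let $\omega$ belong to the Bari--Stechkin class and let $\mathcal{H}$ be either $\mathcal{H}^\omega$ or $\mathcal{H}_0^\omega$. Then: (a) $a\in\mathcal{H}$ is invertible in $\mathcal{H}$ if and only if $a(t)\ne0$ for all $t\in\mathbb{T}$; (b) $S$ is bounded on $\mathcal{H}$: for every $f\in\mathcal{H}$ the principal value $(Sf)(t)$ exists for every $t\in\mathbb{T}$, $Sf\in\mathcal{H}$, and $S:\mathcal{H}\to\mathcal{H}$ is a bounded linear operator; (c) for every $a\in\mathcal{H}$, the operator $aS-SaI:\ f\mapsto a\,Sf-S(af)$ is compact on $\mathcal{H}$.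 -/

import Mathlib

open Filter Topology MeasureTheory Set

/-- `φ` is almost increasing on the set `s`. -/
def AlmostIncreasingOn (φ : ℝ → ℝ) (s : Set ℝ) : Prop :=
  ∃ A : ℝ, 0 < A ∧ ∀ x ∈ s, ∀ y ∈ s, x ≤ y → φ x ≤ A * φ y

/-- The Bari-Stechkin class of functions `ω : (0, π] → [0, ∞)`. Only the values on `(0, π]` are used.
The integrability field says that the integrals `∫ ω(y) / y dy` exist (so `ω` is measurable);
it implies that the integrals `∫ ω(y) / y² dy` over `[x, π]` exist for `x > 0`. -/
structure BariStechkin where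
  toFun : ℝ → ℝ
  pos : ∀ x ∈ Ioc 0 Real.pi, 0 < toFun x
  almostIncreasing : AlmostIncreasingOn toFun (Ioc 0 Real.pi)
  tendsto_zero : Tendsto toFun (𝓝[>] 0) (𝓝 0)
  integrable : IntegrableOn (fun y => toFun y / y) (Ioc 0 Real.pi)
  bound_zero : ∃ C : ℝ, ∀ x ∈ Ioc 0 Real.pi,
    1 / toFun x * ∫ y in Ioc 0 x, toFun y / y ≤ C
  bound_pi : ∃ C : ℝ, ∀ x ∈ Ioc 0 Real.pi,
    x / toFun x * ∫ y in Ioc x Real.pi, toFun y / y ^ 2 ≤ C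

instance : CoeFun BariStechkin fun _ => ℝ → ℝ := ⟨BariStechkin.toFun⟩

/-- The modulus of continuity of a (bounded) function on the unit circle. -/
noncomputable def modulusCont (f : Circle → ℂ) (x : ℝ) : ℝ :=
  sSup {r : ℝ | ∃ h y : ℝ, |h| ≤ x ∧ r = ‖f (Circle.exp (y + h)) - f (Circle.exp y)‖}

theorem modulusCont_nonneg (f : Circle → ℂ) (x : ℝ) : 0 ≤ modulusCont f x :=
  Real.sSup_nonneg (by rintro r ⟨h, y, -, rfl⟩; exact norm_nonneg _)

theorem le_modulusCont (f : C(Circle, ℂ)) {x h : ℝ} (hx : |h| ≤ x) (y : ℝ) :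
    ‖f (Circle.exp (y + h)) - f (Circle.exp y)‖ ≤ modulusCont f x := by
  refine le_csSup ⟨‖f‖ + ‖f‖, ?_⟩ ⟨h, y, hx, rfl⟩
  rintro r ⟨h, y, -, rfl⟩
  exact (norm_sub_le _ _).trans (add_le_add (f.norm_coe_le_norm _) (f.norm_coe_le_norm _))

theorem modulusCont_le {f : Circle → ℂ} {x B : ℝ} (hB : 0 ≤ B)
    (H : ∀ h y : ℝ, |h| ≤ x → ‖f (Circle.exp (y + h)) - f (Circle.exp y)‖ ≤ B) :
    modulusCont f x ≤ B :=
  Real.sSup_le (by rintro r ⟨h, y, hh, rfl⟩; exact H h y hh) hB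

theorem modulusCont_add_le (f g : C(Circle, ℂ)) (x : ℝ) :
    modulusCont (f + g : C(Circle, ℂ)) x ≤ modulusCont f x + modulusCont g x := by
  refine modulusCont_le (add_nonneg (modulusCont_nonneg _ _) (modulusCont_nonneg _ _)) ?_
  intro h y hh
  refine le_trans (le_of_eq ?_) ((norm_add_le _ _).trans
    (add_le_add (le_modulusCont f hh y) (le_modulusCont g hh y)))
  congr 1
  simp only [ContinuousMap.add_apply]
  ring

theorem modulusCont_mul_le (f g : C(Circle, ℂ)) (x : ℝ) :
    modulusCont (f * g : C(Circle, ℂ)) x ≤ ‖f‖ * modulusCont g x + ‖g‖ * modulusCont f x := by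
  have hf := modulusCont_nonneg f x
  have hg := modulusCont_nonneg g x
  refine modulusCont_le (by positivity) ?_
  intro h y hh
  have e : (f * g) (Circle.exp (y + h)) - (f * g) (Circle.exp y)
      = f (Circle.exp (y + h)) * (g (Circle.exp (y + h)) - g (Circle.exp y))
        + g (Circle.exp y) * (f (Circle.exp (y + h)) - f (Circle.exp y)) := by
    simp only [ContinuousMap.mul_apply]
    ring
  rw [e]
  refine (norm_add_le _ _).trans ?_
  rw [norm_mul, norm_mul]
  exact add_le_add
    (mul_le_mul (f.norm_coe_le_norm _) (le_modulusCont g hh y) (norm_nonneg _) (norm_nonneg _))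
    (mul_le_mul (g.norm_coe_le_norm _) (le_modulusCont f hh y) (norm_nonneg _) (norm_nonneg _))

theorem modulusCont_neg (f : C(Circle, ℂ)) (x : ℝ) :
    modulusCont (-f : C(Circle, ℂ)) x = modulusCont f x := by
  unfold modulusCont
  congr 1
  ext r
  simp only [ContinuousMap.neg_apply, neg_sub_neg, norm_sub_rev]

theorem modulusCont_const (c : ℂ) (x : ℝ) :
    modulusCont (algebraMap ℂ C(Circle, ℂ) c) x = 0 :=
  le_antisymm (modulusCont_le le_rfl (by intro h y _; simp)) (modulusCont_nonneg _ _)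

/-- The set of all quotients `ω(f, x) / ω(x)`, `0 < x ≤ π`. -/
noncomputable def holderQuotients (ω : BariStechkin) (f : Circle → ℂ) : Set ℝ :=
  (fun x => modulusCont f x / ω x) '' Ioc 0 Real.pi

/-- The seminorm `|f|_ω`. -/
noncomputable def holderSeminorm (ω : BariStechkin) (f : Circle → ℂ) : ℝ :=
  sSup (holderQuotients ω f)

theorem holderSeminorm_nonneg (ω : BariStechkin) (f : Circle → ℂ) : 0 ≤ holderSeminorm ω f :=
  Real.sSup_nonneg (by
    rintro r ⟨x, hx, rfl⟩
    exact div_nonneg (modulusCont_nonneg _ _) (ω.pos x hx).le)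

theorem le_holderSeminorm {ω : BariStechkin} {f : Circle → ℂ} (hf : BddAbove (holderQuotients ω f))
    {x : ℝ} (hx : x ∈ Ioc 0 Real.pi) : modulusCont f x / ω x ≤ holderSeminorm ω f :=
  le_csSup hf ⟨x, hx, rfl⟩

theorem quotient_add_le (ω : BariStechkin) (f g : C(Circle, ℂ)) {x : ℝ} (hx : x ∈ Ioc 0 Real.pi) :
    modulusCont (f + g : C(Circle, ℂ)) x / ω x
      ≤ modulusCont f x / ω x + modulusCont g x / ω x := by
  rw [← add_div]
  exact div_le_div_of_nonneg_right (modulusCont_add_le f g x) (ω.pos x hx).le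

theorem quotient_mul_le (ω : BariStechkin) (f g : C(Circle, ℂ)) {x : ℝ} (hx : x ∈ Ioc 0 Real.pi) :
    modulusCont (f * g : C(Circle, ℂ)) x / ω x
      ≤ ‖f‖ * (modulusCont g x / ω x) + ‖g‖ * (modulusCont f x / ω x) := by
  rw [← mul_div_assoc, ← mul_div_assoc, ← add_div]
  exact div_le_div_of_nonneg_right (modulusCont_mul_le f g x) (ω.pos x hx).le

/-- The set `H^ω` of continuous functions with `|f|_ω < ∞`, as a subalgebra of `C(𝕋)`. -/
noncomputable def holderSubalgebra (ω : BariStechkin) : Subalgebra ℂ C(Circle, ℂ) where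
  carrier := {f | BddAbove (holderQuotients ω f)}
  add_mem' := by
    intro f g hf hg
    refine ⟨holderSeminorm ω f + holderSeminorm ω g, ?_⟩
    rintro r ⟨x, hx, rfl⟩
    exact (quotient_add_le ω f g hx).trans
      (add_le_add (le_holderSeminorm hf hx) (le_holderSeminorm hg hx))
  mul_mem' := by
    intro f g hf hg
    refine ⟨‖f‖ * holderSeminorm ω g + ‖g‖ * holderSeminorm ω f, ?_⟩
    rintro r ⟨x, hx, rfl⟩
    exact (quotient_mul_le ω f g hx).trans (add_le_add
      (mul_le_mul_of_nonneg_left (le_holderSeminorm hg hx) (norm_nonneg _))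
      (mul_le_mul_of_nonneg_left (le_holderSeminorm hf hx) (norm_nonneg _)))
  algebraMap_mem' := by
    intro c
    refine ⟨0, ?_⟩
    rintro r ⟨x, hx, rfl⟩
    simp only [modulusCont_const, zero_div, le_refl]

/-- The generalized Hölder space `H^ω`. It is a type of its own (not reducible to the subalgebra)
since it carries the norm `‖f‖_C + |f|_ω` and not the norm induced from `C(𝕋)`. -/
def HolderSpace (ω : BariStechkin) : Type := ↥(holderSubalgebra ω)

namespace HolderSpace

noncomputable instance (ω : BariStechkin) : CommRing (HolderSpace ω) :=
  inferInstanceAs (CommRing ↥(holderSubalgebra ω))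

noncomputable instance (ω : BariStechkin) : Algebra ℂ (HolderSpace ω) :=
  inferInstanceAs (Algebra ℂ ↥(holderSubalgebra ω))

/-- The underlying continuous function. -/
noncomputable def toC {ω : BariStechkin} (f : HolderSpace ω) : C(Circle, ℂ) := f.1

noncomputable instance (ω : BariStechkin) : CoeFun (HolderSpace ω) fun _ => Circle → ℂ := ⟨fun f => f.toC⟩

theorem bdd {ω : BariStechkin} (f : HolderSpace ω) : BddAbove (holderQuotients ω f.toC) := f.2

/-- The norm `‖f‖_C + |f|_ω` of `H^ω`. -/
noncomputable def ringNorm (ω : BariStechkin) : RingNorm (HolderSpace ω) where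
  toFun f := ‖f.toC‖ + holderSeminorm ω f.toC
  map_zero' := by
    have h0 : (0 : HolderSpace ω).toC = algebraMap ℂ C(Circle, ℂ) 0 := by
      rw [map_zero]; rfl
    have h1 : holderSeminorm ω (0 : HolderSpace ω).toC = 0 := by
      refine le_antisymm (Real.sSup_le ?_ le_rfl) (holderSeminorm_nonneg _ _)
      rintro r ⟨x, hx, rfl⟩
      simp only [h0, modulusCont_const, zero_div, le_refl]
    rw [h1, h0, map_zero, norm_zero, add_zero]
  add_le' f g := by
    have h : holderSeminorm ω (f + g).toC ≤ holderSeminorm ω f.toC + holderSeminorm ω g.toC := by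
      refine Real.sSup_le ?_ (add_nonneg (holderSeminorm_nonneg _ _) (holderSeminorm_nonneg _ _))
      rintro r ⟨x, hx, rfl⟩
      exact (quotient_add_le ω f.toC g.toC hx).trans
        (add_le_add (le_holderSeminorm f.bdd hx) (le_holderSeminorm g.bdd hx))
    have h' : ‖(f + g).toC‖ ≤ ‖f.toC‖ + ‖g.toC‖ := norm_add_le f.toC g.toC
    linarith
  neg' f := by
    have h1 : ∀ x, modulusCont (-f).toC x = modulusCont f.toC x := modulusCont_neg f.toC
    have h2 : ‖(-f).toC‖ = ‖f.toC‖ := norm_neg f.toC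
    rw [h2]
    simp only [holderSeminorm, holderQuotients, h1]
  mul_le' f g := by
    have hf := holderSeminorm_nonneg ω f.toC
    have hg := holderSeminorm_nonneg ω g.toC
    have h : holderSeminorm ω (f * g).toC
        ≤ ‖f.toC‖ * holderSeminorm ω g.toC + ‖g.toC‖ * holderSeminorm ω f.toC := by
      refine Real.sSup_le ?_ (by positivity)
      rintro r ⟨x, hx, rfl⟩
      exact (quotient_mul_le ω f.toC g.toC hx).trans (add_le_add
        (mul_le_mul_of_nonneg_left (le_holderSeminorm g.bdd hx) (norm_nonneg _))
        (mul_le_mul_of_nonneg_left (le_holderSeminorm f.bdd hx) (norm_nonneg _)))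
    have h' : ‖(f * g).toC‖ ≤ ‖f.toC‖ * ‖g.toC‖ := norm_mul_le f.toC g.toC
    have h2 : 0 ≤ holderSeminorm ω f.toC * holderSeminorm ω g.toC := mul_nonneg hf hg
    nlinarith
  eq_zero_of_map_eq_zero' f hf := by
    have h : ‖f.toC‖ = 0 := by
      have h1 := norm_nonneg f.toC
      have h2 := holderSeminorm_nonneg ω f.toC
      linarith
    exact Subtype.ext (norm_eq_zero.mp h)

noncomputable instance (ω : BariStechkin) : NormedCommRing (HolderSpace ω) :=
  { RingNorm.toNormedRing (ringNorm ω), (inferInstance : CommRing (HolderSpace ω)) with }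

theorem norm_def {ω : BariStechkin} (f : HolderSpace ω) :
    ‖f‖ = ‖f.toC‖ + holderSeminorm ω f.toC := rfl

noncomputable instance (ω : BariStechkin) : NormedAlgebra ℂ (HolderSpace ω) where
  norm_smul_le c f := by
    have hm : ∀ x, modulusCont (c • f).toC x ≤ ‖c‖ * modulusCont f.toC x := by
      intro x
      refine modulusCont_le (mul_nonneg (norm_nonneg _) (modulusCont_nonneg _ _)) ?_
      intro h y hh
      have e : (c • f).toC (Circle.exp (y + h)) - (c • f).toC (Circle.exp y)
          = c * (f.toC (Circle.exp (y + h)) - f.toC (Circle.exp y)) := by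
        rw [mul_sub]; rfl
      rw [e, norm_mul]
      exact mul_le_mul_of_nonneg_left (le_modulusCont f.toC hh y) (norm_nonneg _)
    have h : holderSeminorm ω (c • f).toC ≤ ‖c‖ * holderSeminorm ω f.toC := by
      refine Real.sSup_le ?_ (mul_nonneg (norm_nonneg _) (holderSeminorm_nonneg _ _))
      rintro r ⟨x, hx, rfl⟩
      refine (div_le_div_of_nonneg_right (hm x) (ω.pos x hx).le).trans ?_
      rw [mul_div_assoc]
      exact mul_le_mul_of_nonneg_left (le_holderSeminorm f.bdd hx) (norm_nonneg _)
    have h' : ‖(c • f).toC‖ ≤ ‖c‖ * ‖f.toC‖ := norm_smul_le c f.toC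
    rw [norm_def, norm_def]
    linarith

end HolderSpace

/-- The subspace `H_0^ω` of the functions `f` in `H^ω` with `ω(f, x) / ω(x) → 0` as `x → 0+`,
with the norm of `H^ω`. -/
noncomputable def littleHolder (ω : BariStechkin) : Subalgebra ℂ (HolderSpace ω) where
  carrier := {f | Tendsto (fun x => modulusCont f x / ω x) (𝓝[>] 0) (𝓝 0)}
  add_mem' := by
    intro f g hf hg
    have hs : Tendsto (fun x => modulusCont f x / ω x + modulusCont g x / ω x)
        (𝓝[>] 0) (𝓝 0) := by simpa using Tendsto.add hf hg
    have hI : Ioc 0 Real.pi ∈ 𝓝[>] (0 : ℝ) := Ioc_mem_nhdsGT Real.pi_pos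
    refine squeeze_zero' ?_ ?_ hs
    · filter_upwards [hI] with x hx
      exact div_nonneg (modulusCont_nonneg _ _) (ω.pos x hx).le
    · filter_upwards [hI] with x hx
      exact quotient_add_le ω f.toC g.toC hx
  mul_mem' := by
    intro f g hf hg
    have hs : Tendsto (fun x => ‖f.toC‖ * (modulusCont g x / ω x)
        + ‖g.toC‖ * (modulusCont f x / ω x)) (𝓝[>] 0) (𝓝 0) := by
      simpa using Tendsto.add (Tendsto.const_mul ‖f.toC‖ hg) (Tendsto.const_mul ‖g.toC‖ hf)
    have hI : Ioc 0 Real.pi ∈ 𝓝[>] (0 : ℝ) := Ioc_mem_nhdsGT Real.pi_pos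
    refine squeeze_zero' ?_ ?_ hs
    · filter_upwards [hI] with x hx
      exact div_nonneg (modulusCont_nonneg _ _) (ω.pos x hx).le
    · filter_upwards [hI] with x hx
      exact quotient_mul_le ω f.toC g.toC hx
  algebraMap_mem' := by
    intro c
    have h : ∀ x, modulusCont (algebraMap ℂ (HolderSpace ω) c) x = 0 := modulusCont_const c
    simp only [mem_ofPred_eq, h, zero_div, tendsto_const_nhds]

/-- The truncated Cauchy integral `(1 / πi) ∫ φ(τ) / (τ - t) dτ` over `τ ∈ 𝕋`, `|τ - t| > ε`,
with `τ = exp(iθ)`, `dτ = i exp(iθ) dθ` (counterclockwise orientation). -/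
noncomputable def truncatedCauchy (φ : Circle → ℂ) (t : Circle) (ε : ℝ) : ℂ :=
  1 / (Real.pi * Complex.I) *
    ∫ θ in {θ : ℝ | θ ∈ Ioc (-Real.pi) Real.pi ∧ ε < ‖(Circle.exp θ : ℂ) - (t : ℂ)‖},
      φ (Circle.exp θ) / ((Circle.exp θ : ℂ) - (t : ℂ)) * (Complex.I * (Circle.exp θ : ℂ))

/-- `ψ = S φ`: at every point `t` of the circle the principal value
`(1 / πi) v.p. ∫ φ(τ) / (τ - t) dτ` exists and equals `ψ(t)`. -/
def IsCauchySingularIntegral (φ ψ : Circle → ℂ) : Prop :=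
  ∀ t : Circle, Tendsto (truncatedCauchy φ t) (𝓝[>] 0) (𝓝 (ψ t))

/-! Everything reduces to one bilinear operator, `T(a, f)(t) = ∫ (a(t) - a(τ)) f(τ) / (τ - t) dτ`
(`commIntegral`), which converges absolutely as soon as `∫₀^π ω(a, u) / u du` is finite. The
principal value of `∫ dτ / (τ - t)` is `πi`, hence `S f = f - (1/πi) T(f, 1)`, and algebra under the
integral sign gives `a S f - S (a f) = (1/πi) T(a, f)`.

The central estimate (`norm_commIntegral_sub_le`) bounds the increment of `T(a, f)` over a step `h`
by the Zygmund expression `∫₀ʰ ω(a, u)/u du + h ∫ₕ^π ω(a, u)/u² du` plus a multiple of `ω(a, h)`.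
The two integral conditions on `ω` say precisely that the Zygmund expression is `O(ω(h))` when `ω(a,
·) ≤ M ω`. What matters is how `f` enters: only through `‖f‖ + ∫₀^π ω(f, u)/u du`, a quantity weaker
than the norm of `H^ω` (`HolderSpace.exists_norm_comm_le`).

Taking `f = 1` gives the boundedness of `S`. Compactness of the commutator follows from the weak
dependence on `f`: by Arzelà–Ascoli the functions bounded by one with modulus at most `ω` form a
compact set in `C(𝕋)`, by dominated convergence the Dini integral is continuous along it, so `f ↦
T(a, f)` maps it continuously into `H^ω` with compact image.

For `H_0^ω` the same estimate is run with the majorant `ε ω(u) + c u²`; its second term contributes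
`O(h)`, which is `o(ω(h))`. As `H_0^ω` is closed in `H^ω`, compactness restricts to it.
Invertibility is the identity `1/a - 1/b = (b - a)/(ab)`. -/

/-! ### The kernel of the Cauchy integral in angular coordinates -/

/-- The kernel `i e^{iu} / (e^{iu} - 1)`, that is, `dτ / (τ - t)` for `τ = t e^{iu}`. -/
noncomputable def cauchyKernel (u : ℝ) : ℂ :=
  Complex.I * (Circle.exp u : ℂ) / ((Circle.exp u : ℂ) - 1)

theorem norm_exp_sub_one_eq (u : ℝ) : ‖(Circle.exp u : ℂ) - 1‖ = 2 * |Real.sin (u / 2)| := by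
  have h := Complex.norm_exp_I_mul_ofReal_sub_one u
  rw [mul_comm] at h
  rw [Circle.coe_exp, h, norm_mul, Real.norm_eq_abs, Real.norm_eq_abs, abs_two]

theorem norm_exp_sub_one_le (u : ℝ) : ‖(Circle.exp u : ℂ) - 1‖ ≤ |u| := by
  have h := Real.norm_exp_I_mul_ofReal_sub_one_le (x := u)
  rw [mul_comm] at h
  rwa [Circle.coe_exp]

theorem le_norm_exp_sub_one {u : ℝ} (hu : |u| ≤ Real.pi) :
    2 / Real.pi * |u| ≤ ‖(Circle.exp u : ℂ) - 1‖ := by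
  have h := Real.mul_abs_le_abs_sin (x := u / 2) (by rw [abs_div, abs_two]; linarith)
  rw [norm_exp_sub_one_eq]
  rw [abs_div, abs_two] at h
  linarith

/-- Halving the constant `2/π` extends the chord bound beyond `π`: a shift by `2π` brings `π < |u| ≤
4π/3` back to `[2π/3, π]`, where the chord is at least `4/3`. The range is what `u - h` needs when
`|u| ≤ π` and `h ≤ π/3`. -/
theorem abs_div_pi_le_norm_exp_sub_one {u : ℝ} (hu : |u| ≤ 4 * Real.pi / 3) :
    |u| / Real.pi ≤ ‖(Circle.exp u : ℂ) - 1‖ := by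
  have hpi := Real.pi_pos
  have key : ∀ v : ℝ, |v| ≤ Real.pi → 2 * Real.pi / 3 ≤ |v| →
      4 / 3 ≤ ‖(Circle.exp v : ℂ) - 1‖ := by
    intro v h1 h2
    refine le_trans ?_ (le_norm_exp_sub_one h1)
    rw [div_mul_eq_mul_div, div_le_div_iff₀ (by norm_num) hpi]
    linarith
  rcases le_or_gt |u| Real.pi with h | h
  · refine le_trans ?_ (le_norm_exp_sub_one h)
    rw [div_mul_eq_mul_div]
    gcongr
    linarith [abs_nonneg u]
  · have h43 : |u| / Real.pi ≤ 4 / 3 := by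
      rw [div_le_div_iff₀ hpi (by norm_num)]; linarith
    refine h43.trans ?_
    rcases le_or_gt 0 u with h0 | h0
    · rw [abs_of_nonneg h0] at h hu
      rw [← Circle.periodic_exp.sub_eq u]
      have e : |u - 2 * Real.pi| = 2 * Real.pi - u := by
        rw [abs_of_nonpos (by linarith)]; ring
      exact key _ (by rw [e]; linarith) (by rw [e]; linarith)
    · rw [abs_of_neg h0] at h hu
      rw [← Circle.periodic_exp u]
      have e : |u + 2 * Real.pi| = 2 * Real.pi + u := by
        rw [abs_of_nonneg (by linarith)]; ring
      exact key _ (by rw [e]; linarith) (by rw [e]; linarith)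

theorem exp_ne_one {u : ℝ} (h0 : u ≠ 0) (hu : |u| ≤ 4 * Real.pi / 3) :
    (Circle.exp u : ℂ) - 1 ≠ 0 := by
  have h1 : 0 < |u| / Real.pi := div_pos (abs_pos.mpr h0) Real.pi_pos
  exact norm_pos_iff.mp (h1.trans_le (abs_div_pi_le_norm_exp_sub_one hu))

theorem norm_cauchyKernel_le {u : ℝ} (hu : |u| ≤ Real.pi) :
    ‖cauchyKernel u‖ ≤ Real.pi / 2 / |u| := by
  rcases eq_or_ne u 0 with rfl | h0
  · simp [cauchyKernel]
  have hpi := Real.pi_pos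
  have h1 : 0 < |u| := abs_pos.mpr h0
  rw [cauchyKernel, norm_div, norm_mul, Complex.norm_I, Circle.norm_coe, mul_one]
  have h2 : 1 / ‖(Circle.exp u : ℂ) - 1‖ ≤ 1 / (2 / Real.pi * |u|) :=
    one_div_le_one_div_of_le (by positivity) (le_norm_exp_sub_one hu)
  refine h2.trans (le_of_eq ?_)
  field_simp

/-- The kernel equals `cot(u/2)/2 + i/2`: its singular part is odd. Every cancellation used below
comes from this. -/
theorem cauchyKernel_add_neg {u : ℝ} (h0 : u ≠ 0) (hu : |u| ≤ Real.pi) :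
    cauchyKernel u + cauchyKernel (-u) = Complex.I := by
  have h1 := exp_ne_one h0 (by linarith [Real.pi_pos])
  have h2 : (Circle.exp u : ℂ) ≠ 0 := Circle.coe_ne_zero _
  rw [cauchyKernel, cauchyKernel, Circle.exp_neg, Circle.coe_inv]
  have h3 : (Circle.exp u : ℂ)⁻¹ - 1 ≠ 0 := by
    rw [show (Circle.exp u : ℂ)⁻¹ - 1 = -((Circle.exp u : ℂ) - 1) / (Circle.exp u : ℂ) by
      field_simp; ring]
    exact div_ne_zero (neg_ne_zero.mpr h1) h2
  have h4 : 1 - (Circle.exp u : ℂ) ≠ 0 := by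
    intro h; apply h1; linear_combination -h
  field_simp
  ring

/-- Over a common denominator the numerator carries the factor `e^{ih} - 1`, of size `h`, while both
chords are comparable to `|u|` because `2h ≤ |u|` forces `|u - h| ≥ |u|/2`. -/
theorem norm_cauchyKernel_sub_le {u h : ℝ} (hh : 0 < h) (hh' : h ≤ Real.pi / 3)
    (h1 : 2 * h ≤ |u|) (h2 : |u| ≤ Real.pi) :
    ‖cauchyKernel (u - h) - cauchyKernel u‖ ≤ Real.pi ^ 2 * h / u ^ 2 := by
  have hpi := Real.pi_pos
  have hu : 0 < |u| := by linarith
  have h3 : |u| / 2 ≤ |u - h| := by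
    have := abs_sub_abs_le_abs_sub u h
    rw [abs_of_pos hh] at this
    linarith
  have h4 : |u - h| ≤ 4 * Real.pi / 3 := by
    have := abs_sub u h
    rw [abs_of_pos hh] at this
    linarith
  have n1 : (Circle.exp u : ℂ) - 1 ≠ 0 :=
    exp_ne_one (abs_pos.mp hu) (by linarith)
  have n2 : (Circle.exp (u - h) : ℂ) - 1 ≠ 0 :=
    exp_ne_one (abs_pos.mp (by linarith)) h4
  have e : cauchyKernel (u - h) - cauchyKernel u
      = Complex.I * ((Circle.exp (u - h) : ℂ) * ((Circle.exp h : ℂ) - 1))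
        / (((Circle.exp (u - h) : ℂ) - 1) * ((Circle.exp u : ℂ) - 1)) := by
    have e1 : (Circle.exp u : ℂ) = (Circle.exp (u - h) : ℂ) * (Circle.exp h : ℂ) := by
      rw [← Circle.coe_mul, ← Circle.exp_add, sub_add_cancel]
    rw [cauchyKernel, cauchyKernel, div_sub_div _ _ n2 n1]
    congr 1
    rw [e1]
    ring
  rw [e, norm_div, norm_mul, norm_mul, norm_mul, Complex.norm_I, Circle.norm_coe, one_mul, one_mul]
  have l1 : |u| / (2 * Real.pi) ≤ ‖(Circle.exp (u - h) : ℂ) - 1‖ := by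
    refine le_trans ?_ (abs_div_pi_le_norm_exp_sub_one h4)
    rw [div_mul_eq_div_div]
    gcongr
  have l2 := le_norm_exp_sub_one h2
  have l3 := norm_exp_sub_one_le h
  rw [abs_of_pos hh] at l3
  calc ‖(Circle.exp h : ℂ) - 1‖ / (‖(Circle.exp (u - h) : ℂ) - 1‖ * ‖(Circle.exp u : ℂ) - 1‖)
      ≤ h / (|u| / (2 * Real.pi) * (2 / Real.pi * |u|)) := by gcongr
    _ = Real.pi ^ 2 * h / u ^ 2 := by
      rw [← sq_abs u]
      field_simp

theorem measurable_cauchyKernel : Measurable cauchyKernel := by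
  unfold cauchyKernel
  have : Continuous fun u : ℝ => (Circle.exp u : ℂ) := by fun_prop
  exact (this.measurable.const_mul _).div (this.measurable.sub_const _)

/-! ### The modulus of continuity -/

theorem norm_sub_le_modulusCont (a : C(Circle, ℂ)) (t : Circle) {u x : ℝ} (hu : |u| ≤ x) :
    ‖a (t * Circle.exp u) - a t‖ ≤ modulusCont a x := by
  have h := le_modulusCont a hu (Complex.arg t)
  rwa [Circle.exp_add, Circle.exp_arg] at h

theorem modulusCont_mono (a : C(Circle, ℂ)) : Monotone (modulusCont a) := fun _ _ hxy =>
  modulusCont_le (modulusCont_nonneg _ _) fun _ y hh => le_modulusCont a (hh.trans hxy) y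

theorem modulusCont_le_norm (a : C(Circle, ℂ)) (x : ℝ) : modulusCont a x ≤ 2 * ‖a‖ := by
  refine modulusCont_le (by positivity) fun h y _ => (norm_sub_le _ _).trans ?_
  linarith [a.norm_coe_le_norm (Circle.exp (y + h)), a.norm_coe_le_norm (Circle.exp y)]

theorem modulusCont_le_of_pos {f : Circle → ℂ} {x B : ℝ} (hB : 0 ≤ B)
    (H : ∀ h y : ℝ, 0 < h → h ≤ x → ‖f (Circle.exp (y + h)) - f (Circle.exp y)‖ ≤ B) :
    modulusCont f x ≤ B := by
  refine modulusCont_le hB fun h y hh => ?_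
  rcases lt_trichotomy h 0 with h0 | rfl | h0
  · rw [abs_of_neg h0] at hh
    have := H (-h) (y + h) (by linarith) hh
    rwa [add_neg_cancel_right, norm_sub_rev] at this
  · simpa using hB
  · rw [abs_of_pos h0] at hh
    exact H h y h0 hh

/-- The Dini condition for a continuous function. -/
def IsDini (a : C(Circle, ℂ)) : Prop :=
  IntervalIntegrable (fun u => modulusCont a u / u) volume 0 Real.pi

/-- The Dini integral of the modulus of continuity. -/
noncomputable def diniIntegral (a : C(Circle, ℂ)) : ℝ :=
  ∫ u in (0 : ℝ)..Real.pi, modulusCont a u / u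

theorem diniIntegral_nonneg (a : C(Circle, ℂ)) : 0 ≤ diniIntegral a :=
  intervalIntegral.integral_nonneg Real.pi_pos.le fun _ hu =>
    div_nonneg (modulusCont_nonneg _ _) hu.1

theorem IsDini.mono {a : C(Circle, ℂ)} (ha : IsDini a) {r s : ℝ} (hr : 0 ≤ r) (hrs : r ≤ s)
    (hs : s ≤ Real.pi) : IntervalIntegrable (fun u => modulusCont a u / u) volume r s := by
  refine IntervalIntegrable.mono_set ha ?_
  rw [uIcc_of_le hrs, uIcc_of_le Real.pi_pos.le]
  exact Icc_subset_Icc hr hs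

theorem IsDini.div_sq {a : C(Circle, ℂ)} (ha : IsDini a) {r s : ℝ} (hr : 0 < r) (hrs : r ≤ s)
    (hs : s ≤ Real.pi) : IntervalIntegrable (fun u => modulusCont a u / u ^ 2) volume r s := by
  have h := (ha.mono hr.le hrs hs).mul_continuousOn (g := fun u => u⁻¹) (by
    rw [uIcc_of_le hrs]
    exact continuousOn_id.inv₀ fun u hu => (hr.trans_le hu.1).ne')
  refine h.congr (fun u _ => ?_)
  simp only [div_eq_mul_inv, sq, mul_inv, mul_assoc]

theorem IsDini.abs {a : C(Circle, ℂ)} (ha : IsDini a) :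
    IntervalIntegrable (fun u => modulusCont a |u| / |u|) volume (-Real.pi) Real.pi := by
  have h1 : IntervalIntegrable (fun u => modulusCont a |u| / |u|) volume 0 Real.pi := by
    refine IntervalIntegrable.congr (fun u hu => ?_) ha
    rw [uIoc_of_le Real.pi_pos.le] at hu
    simp only [abs_of_pos hu.1]
  have h2 := (IntervalIntegrable.iff_comp_neg).mp h1
  simp only [abs_neg, neg_zero] at h2
  exact h2.symm.trans h1

theorem integral_modulusCont_abs {a : C(Circle, ℂ)} (ha : IsDini a) {r : ℝ} (hr : 0 ≤ r)
    (hr' : r ≤ Real.pi) :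
    ∫ u in -r..r, modulusCont a |u| / |u| = 2 * ∫ u in (0 : ℝ)..r, modulusCont a u / u := by
  have hsub : ∀ p q : ℝ, -r ≤ p → p ≤ q → q ≤ r →
      IntervalIntegrable (fun u => modulusCont a |u| / |u|) volume p q := by
    intro p q hp hpq hq
    refine IntervalIntegrable.mono_set ha.abs ?_
    rw [uIcc_of_le hpq, uIcc_of_le (by linarith [Real.pi_pos])]
    exact Icc_subset_Icc (by linarith) (by linarith)
  have e1 : ∫ u in (0 : ℝ)..r, modulusCont a |u| / |u|
      = ∫ u in (0 : ℝ)..r, modulusCont a u / u := by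
    refine intervalIntegral.integral_congr fun u hu => ?_
    rw [uIcc_of_le hr] at hu
    simp only [abs_of_nonneg hu.1]
  have e2 : ∫ u in -r..0, modulusCont a |u| / |u|
      = ∫ u in (0 : ℝ)..r, modulusCont a |u| / |u| := by
    have := intervalIntegral.integral_comp_neg (a := 0) (b := r)
      (fun u => modulusCont a |u| / |u|)
    simp only [abs_neg, neg_zero] at this
    exact this.symm
  rw [← intervalIntegral.integral_add_adjacent_intervals (hsub (-r) 0 le_rfl (by linarith) hr)
    (hsub 0 r (by linarith) hr le_rfl), e2, e1]
  ring

/-! ### The bilinear singular integral -/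

/-- The integrand `(a(t) - a(τ)) f(τ) dτ / (τ - t)` in the coordinate `τ = t e^{iu}`. -/
noncomputable def commIntegrand (a f : C(Circle, ℂ)) (t : Circle) (u : ℝ) : ℂ :=
  (a t - a (t * Circle.exp u)) * f (t * Circle.exp u) * cauchyKernel u

/-- `∫ (a(t) - a(τ)) f(τ) / (τ - t) dτ` over the unit circle. -/
noncomputable def commIntegral (a f : C(Circle, ℂ)) (t : Circle) : ℂ :=
  ∫ u in -Real.pi..Real.pi, commIntegrand a f t u

/-- The zero of `a(t) - a(τ)` tames the pole, so `f` is needed only in sup norm. -/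
theorem norm_commIntegrand_le (a f : C(Circle, ℂ)) (t : Circle) {u : ℝ} (hu : |u| ≤ Real.pi) :
    ‖commIntegrand a f t u‖ ≤ Real.pi / 2 * ‖f‖ * (modulusCont a |u| / |u|) := by
  have h1 : ‖a t - a (t * Circle.exp u)‖ ≤ modulusCont a |u| := by
    rw [norm_sub_rev]; exact norm_sub_le_modulusCont a t le_rfl
  have h2 := f.norm_coe_le_norm (t * Circle.exp u)
  have h3 := norm_cauchyKernel_le hu
  have h4 := modulusCont_nonneg a |u|
  rw [commIntegrand, norm_mul, norm_mul]
  calc _ ≤ modulusCont a |u| * ‖f‖ * (Real.pi / 2 / |u|) := by gcongr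
    _ = _ := by ring

theorem measurable_commIntegrand (a f : C(Circle, ℂ)) (t : Circle) :
    Measurable (commIntegrand a f t) := by
  have h : Continuous fun u : ℝ => (a t - a (t * Circle.exp u)) * f (t * Circle.exp u) := by
    fun_prop
  exact h.measurable.mul measurable_cauchyKernel

theorem abs_le_of_mem_uIoc {u r : ℝ} (hr : 0 ≤ r) (hu : u ∈ uIoc (-r) r) : |u| ≤ r := by
  rw [uIoc_of_le (by linarith)] at hu
  exact abs_le.mpr ⟨hu.1.le, hu.2⟩

theorem intervalIntegrable_commIntegrand {a : C(Circle, ℂ)} (ha : IsDini a) (f : C(Circle, ℂ))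
    (t : Circle) : IntervalIntegrable (commIntegrand a f t) volume (-Real.pi) Real.pi := by
  refine IntervalIntegrable.mono_fun' (ha.abs.const_mul (Real.pi / 2 * ‖f‖))
    (measurable_commIntegrand a f t).aestronglyMeasurable ?_
  refine (ae_restrict_iff' measurableSet_uIoc).mpr (Eventually.of_forall fun u hu => ?_)
  exact norm_commIntegrand_le a f t (abs_le_of_mem_uIoc Real.pi_pos.le hu)

theorem periodic_commIntegrand (a f : C(Circle, ℂ)) (t : Circle) :
    Function.Periodic (commIntegrand a f t) (2 * Real.pi) := fun u => by
  simp only [commIntegrand, cauchyKernel, Circle.periodic_exp u]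

theorem continuous_commIntegral {a : C(Circle, ℂ)} (ha : IsDini a) (f : C(Circle, ℂ)) :
    Continuous (commIntegral a f) := by
  refine intervalIntegral.continuous_of_dominated_interval
    (bound := fun u => Real.pi / 2 * ‖f‖ * (modulusCont a |u| / |u|))
    (fun t => (measurable_commIntegrand a f t).aestronglyMeasurable)
    (fun t => Eventually.of_forall fun u hu =>
      norm_commIntegrand_le a f t (abs_le_of_mem_uIoc Real.pi_pos.le hu))
    (ha.abs.const_mul _) (Eventually.of_forall fun u _ => ?_)
  unfold commIntegrand
  fun_prop

theorem norm_commIntegral_le {a : C(Circle, ℂ)} (ha : IsDini a) (f : C(Circle, ℂ)) (t : Circle) :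
    ‖commIntegral a f t‖ ≤ Real.pi * ‖f‖ * diniIntegral a := by
  have h := intervalIntegral.norm_integral_le_of_norm_le (f := commIntegrand a f t)
    (μ := volume) (by linarith [Real.pi_pos] : -Real.pi ≤ Real.pi)
    (Eventually.of_forall fun u hu => norm_commIntegrand_le a f t
      (abs_le.mpr ⟨hu.1.le, hu.2⟩)) (ha.abs.const_mul (Real.pi / 2 * ‖f‖))
  refine h.trans (le_of_eq ?_)
  rw [intervalIntegral.integral_const_mul, integral_modulusCont_abs ha Real.pi_pos.le le_rfl,
    diniIntegral]
  ring

/-! ### Modulus of continuity of the singular integral -/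

/-- The local part `∫₀ʰ ω(a, u) / u du + h ∫ₕ^π ω(a, u) / u² du` of the estimates. -/
noncomputable def zygmundIntegral (a : C(Circle, ℂ)) (h : ℝ) : ℝ :=
  (∫ u in (0 : ℝ)..h, modulusCont a u / u) + h * ∫ u in h..Real.pi, modulusCont a u / u ^ 2

/-- On `[h, 3h]` one has `1/u ≤ 3h/u²`, so the extra piece is absorbed by the tail of the Zygmund
expression and no doubling property is needed. -/
theorem integral_modulusCont_triple_le {a : C(Circle, ℂ)} (ha : IsDini a) {h : ℝ} (hh : 0 < h)
    (hh' : h ≤ Real.pi / 3) :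
    ∫ u in (0 : ℝ)..3 * h, modulusCont a u / u
      ≤ (∫ u in (0 : ℝ)..h, modulusCont a u / u)
        + 3 * h * ∫ u in h..Real.pi, modulusCont a u / u ^ 2 := by
  have hpi := Real.pi_pos
  rw [← intervalIntegral.integral_add_adjacent_intervals
    (ha.mono le_rfl hh.le (by linarith)) (ha.mono hh.le (by linarith : h ≤ 3 * h) (by linarith))]
  gcongr
  have h1 : ∫ u in h..3 * h, modulusCont a u / u
      ≤ ∫ u in h..3 * h, 3 * h * (modulusCont a u / u ^ 2) := by
    refine intervalIntegral.integral_mono_on (by linarith)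
      (ha.mono hh.le (by linarith) (by linarith))
      ((ha.div_sq hh (by linarith) (by linarith)).const_mul _) fun u hu => ?_
    have hu0 : 0 < u := hh.trans_le hu.1
    have := modulusCont_nonneg a u
    rw [mul_div_assoc', div_le_div_iff₀ hu0 (by positivity)]
    have h2 : modulusCont a u * u * u ≤ modulusCont a u * u * (3 * h) :=
      mul_le_mul_of_nonneg_left hu.2 (by positivity)
    linarith
  refine h1.trans ?_
  rw [intervalIntegral.integral_const_mul]
  refine mul_le_mul_of_nonneg_left ?_ (by positivity)
  refine intervalIntegral.integral_mono_interval le_rfl (by linarith) (by linarith) ?_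
    (ha.div_sq hh (by linarith) le_rfl)
  exact Eventually.of_forall fun u => div_nonneg (modulusCont_nonneg _ _) (sq_nonneg _)

theorem norm_integral_near_le {a : C(Circle, ℂ)} (ha : IsDini a) (f : C(Circle, ℂ)) (t : Circle)
    {h p q : ℝ} (hh : 0 < h) (hh' : h ≤ Real.pi / 3) (hp : -(3 * h) ≤ p) (hpq : p ≤ q)
    (hq : q ≤ 3 * h) :
    ‖∫ u in p..q, commIntegrand a f t u‖
      ≤ Real.pi * ‖f‖ * ∫ u in (0 : ℝ)..3 * h, modulusCont a u / u := by
  have hpi := Real.pi_pos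
  have hsub : ∀ c d : ℝ, -(3 * h) ≤ c → c ≤ d → d ≤ 3 * h →
      IntervalIntegrable (fun u => modulusCont a |u| / |u|) volume c d := by
    intro c d hc hcd hd
    refine IntervalIntegrable.mono_set ha.abs ?_
    rw [uIcc_of_le hcd, uIcc_of_le (by linarith)]
    exact Icc_subset_Icc (by linarith) (by linarith)
  have h1 := intervalIntegral.norm_integral_le_of_norm_le (f := commIntegrand a f t)
    (μ := volume) hpq
    (Eventually.of_forall fun u hu => norm_commIntegrand_le a f t
      (abs_le.mpr ⟨by linarith [hu.1], by linarith [hu.2]⟩))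
    ((hsub p q hp hpq hq).const_mul (Real.pi / 2 * ‖f‖))
  refine h1.trans ?_
  rw [intervalIntegral.integral_const_mul]
  have h2 : ∫ u in p..q, modulusCont a |u| / |u|
      ≤ ∫ u in -(3 * h)..3 * h, modulusCont a |u| / |u| :=
    intervalIntegral.integral_mono_interval hp hpq hq
      (Eventually.of_forall fun u => div_nonneg (modulusCont_nonneg _ _) (abs_nonneg _))
      (hsub _ _ le_rfl (by linarith) le_rfl)
  rw [integral_modulusCont_abs ha (by linarith) (by linarith)] at h2
  calc _ ≤ Real.pi / 2 * ‖f‖ * (2 * ∫ u in (0 : ℝ)..3 * h, modulusCont a u / u) := by gcongr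
    _ = _ := by ring

/-- After this shift both integrals evaluate `f` and `a` at the same `τ = t e^{iu}`, so no increment
of `f` over the step `h` ever appears. -/
theorem commIntegral_eq_shift (a f : C(Circle, ℂ)) (t : Circle) (h : ℝ) :
    commIntegral a f (t * Circle.exp h)
      = ∫ u in -Real.pi..Real.pi, commIntegrand a f (t * Circle.exp h) (u - h) := by
  rw [intervalIntegral.integral_comp_sub_right, commIntegral]
  have h1 := (periodic_commIntegrand a f (t * Circle.exp h)).intervalIntegral_add_eq
    (-Real.pi) (-Real.pi - h)
  convert h1 using 2 <;> ring

theorem intervalIntegrable_commIntegrand_shift {a : C(Circle, ℂ)} (ha : IsDini a)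
    (f : C(Circle, ℂ)) (t : Circle) (h p q : ℝ) :
    IntervalIntegrable (fun u => commIntegrand a f t (u - h)) volume p q := by
  have hp : Function.Periodic (fun u => commIntegrand a f t (u - h)) (2 * Real.pi) := fun u => by
    simp only [add_sub_right_comm]
    exact periodic_commIntegrand a f t (u - h)
  refine hp.intervalIntegrable (t := -Real.pi + h) (by positivity) ?_ p q
  have := (intervalIntegrable_commIntegrand ha f t).comp_sub_right h
  convert this using 1
  ring

theorem commIntegrand_shift_sub (a f : C(Circle, ℂ)) (t : Circle) (h u : ℝ) :
    commIntegrand a f (t * Circle.exp h) (u - h) - commIntegrand a f t u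
      = (a (t * Circle.exp h) - a t) * (f (t * Circle.exp u) * cauchyKernel u)
        + (a (t * Circle.exp h) - a (t * Circle.exp u)) * f (t * Circle.exp u)
          * (cauchyKernel (u - h) - cauchyKernel u) := by
  have e : t * Circle.exp h * Circle.exp (u - h) = t * Circle.exp u := by
    rw [mul_assoc, ← Circle.exp_add, add_sub_cancel]
  simp only [commIntegrand, e]
  ring

theorem norm_far_remainder_le (a f : C(Circle, ℂ)) (t : Circle) {h u : ℝ} (hh : 0 < h)
    (hh' : h ≤ Real.pi / 3) (h1 : 2 * h ≤ |u|) (h2 : |u| ≤ Real.pi) :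
    ‖(a (t * Circle.exp h) - a (t * Circle.exp u)) * f (t * Circle.exp u)
          * (cauchyKernel (u - h) - cauchyKernel u)‖
      ≤ 2 * Real.pi ^ 2 * ‖f‖ * h * (modulusCont a |u| / |u| ^ 2) := by
  have b1 : ‖a (t * Circle.exp h) - a (t * Circle.exp u)‖ ≤ 2 * modulusCont a |u| := by
    have e1 := norm_sub_le_modulusCont a t (u := h) (x := |u|) (by rw [abs_of_pos hh]; linarith)
    have e2 := norm_sub_le_modulusCont a t (u := u) (x := |u|) le_rfl
    have e3 := norm_sub_le (a (t * Circle.exp h) - a t) (a (t * Circle.exp u) - a t)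
    rw [sub_sub_sub_cancel_right] at e3
    linarith
  have b2 := f.norm_coe_le_norm (t * Circle.exp u)
  have b3 := norm_cauchyKernel_sub_le hh hh' h1 h2
  have b4 := modulusCont_nonneg a |u|
  rw [norm_mul, norm_mul]
  calc _ ≤ 2 * modulusCont a |u| * ‖f‖ * (Real.pi ^ 2 * h / u ^ 2) := by gcongr
    _ = _ := by rw [sq_abs]; ring

/-- Replacing `f(τ)` by `f(t)` costs a Dini term, and the constant `f(t)` meets `k(u) + k(-u) = i`.
Without this pairing, integration of `|k|` over `|u| ≥ 2h` would lose a logarithm of `h`. -/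
theorem norm_symmetric_sum_le (f : C(Circle, ℂ)) (t : Circle) {u : ℝ} (hu : 0 < u)
    (hu' : u ≤ Real.pi) :
    ‖f (t * Circle.exp u) * cauchyKernel u + f (t * Circle.exp (-u)) * cauchyKernel (-u)‖
      ≤ Real.pi * (modulusCont f u / u) + ‖f‖ := by
  have hu1 : |u| ≤ Real.pi := by rwa [abs_of_pos hu]
  have e : f (t * Circle.exp u) * cauchyKernel u + f (t * Circle.exp (-u)) * cauchyKernel (-u)
      = (f (t * Circle.exp u) - f t) * cauchyKernel u
        + (f (t * Circle.exp (-u)) - f t) * cauchyKernel (-u) + f t * Complex.I := by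
    rw [← cauchyKernel_add_neg hu.ne' hu1]
    ring
  have k1 := norm_cauchyKernel_le hu1
  have k2 := norm_cauchyKernel_le (u := -u) (by rwa [abs_neg])
  have m1 := norm_sub_le_modulusCont f t (u := u) (x := u) (abs_of_pos hu).le
  have m2 := norm_sub_le_modulusCont f t (u := -u) (x := u) (by rw [abs_neg, abs_of_pos hu])
  rw [abs_neg] at k2
  rw [abs_of_pos hu] at k1 k2
  have m0 := modulusCont_nonneg f u
  rw [e]
  refine norm_add₃_le.trans ?_
  rw [norm_mul, norm_mul, norm_mul, Complex.norm_I, mul_one]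
  calc _ ≤ modulusCont f u * (Real.pi / 2 / u) + modulusCont f u * (Real.pi / 2 / u) + ‖f‖ := by
        gcongr
        exact f.norm_coe_le_norm t
    _ = _ := by ring

theorem norm_far_le (a f : C(Circle, ℂ)) (t : Circle) {h u : ℝ} (hh : 0 < h)
    (hh' : h ≤ Real.pi / 3) (h1 : 2 * h ≤ u) (h2 : u ≤ Real.pi) :
    ‖(commIntegrand a f (t * Circle.exp h) (u - h) - commIntegrand a f t u)
        + (commIntegrand a f (t * Circle.exp h) (-u - h) - commIntegrand a f t (-u))‖
      ≤ modulusCont a h * (Real.pi * (modulusCont f u / u) + ‖f‖)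
        + 4 * Real.pi ^ 2 * ‖f‖ * h * (modulusCont a u / u ^ 2) := by
  have hu : 0 < u := by linarith
  have r1 := norm_far_remainder_le a f t (u := u) hh hh' (by rwa [abs_of_pos hu])
    (by rwa [abs_of_pos hu])
  have r2 := norm_far_remainder_le a f t (u := -u) hh hh' (by rwa [abs_neg, abs_of_pos hu])
    (by rwa [abs_neg, abs_of_pos hu])
  rw [abs_neg] at r2
  rw [abs_of_pos hu] at r1 r2
  have s := norm_symmetric_sum_le f t hu h2
  have m := norm_sub_le_modulusCont a t (u := h) (x := h) (abs_of_pos hh).le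
  rw [commIntegrand_shift_sub, commIntegrand_shift_sub, add_add_add_comm, ← mul_add]
  refine (norm_add_le _ _).trans ?_
  rw [norm_mul]
  have s' := mul_le_mul m s (norm_nonneg _) (modulusCont_nonneg a h)
  refine (add_le_add s' ((norm_add_le _ _).trans (add_le_add r1 r2))).trans (le_of_eq ?_)
  ring

theorem intervalIntegral_eq_near_add_far {E : ℝ → ℂ} {r R : ℝ}
    (hE : ∀ p q, IntervalIntegrable E volume p q) :
    ∫ u in -R..R, E u = (∫ u in -r..r, E u) + ∫ u in r..R, (E u + E (-u)) := by
  have hn : IntervalIntegrable (fun u => E (-u)) volume r R := by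
    have := (IntervalIntegrable.iff_comp_neg).mp (hE (-r) (-R))
    simpa using this
  rw [intervalIntegral.integral_add (hE _ _) hn, intervalIntegral.integral_comp_neg,
    ← intervalIntegral.integral_add_adjacent_intervals (hE (-R) (-r)) (hE (-r) R),
    ← intervalIntegral.integral_add_adjacent_intervals (hE (-r) r) (hE r R)]
  ring

/-- Close to the singularity the two integrals are estimated separately. Away from it, the increment
of `a` multiplies the paired kernel, and the increment of the kernel gains `h/u²`. -/
theorem norm_commIntegral_sub_le {a f : C(Circle, ℂ)} (ha : IsDini a) (hf : IsDini f) (t : Circle)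
    {h : ℝ} (hh : 0 < h) (hh' : h ≤ Real.pi / 3) :
    ‖commIntegral a f (t * Circle.exp h) - commIntegral a f t‖
      ≤ (6 * Real.pi + 4 * Real.pi ^ 2) * ‖f‖ * zygmundIntegral a h
        + Real.pi * modulusCont a h * (diniIntegral f + ‖f‖) := by
  have hpi := Real.pi_pos
  set E : ℝ → ℂ := fun u =>
    commIntegrand a f (t * Circle.exp h) (u - h) - commIntegrand a f t u with hE
  have i1 : ∀ p q, IntervalIntegrable
      (fun u => commIntegrand a f (t * Circle.exp h) (u - h)) volume p q :=
    intervalIntegrable_commIntegrand_shift ha f _ h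
  have i2 : ∀ p q, IntervalIntegrable (commIntegrand a f t) volume p q := fun p q => by
    simpa using intervalIntegrable_commIntegrand_shift ha f t 0 p q
  have e1 : commIntegral a f (t * Circle.exp h) - commIntegral a f t
      = ∫ u in -Real.pi..Real.pi, E u := by
    rw [commIntegral_eq_shift, commIntegral, intervalIntegral.integral_sub (i1 _ _) (i2 _ _)]
  -- Cutting at `2h` keeps the shifted window inside `[-3h, 3h]` and gives `2h ≤ |u|` on the far
  -- part.
  rw [e1, intervalIntegral_eq_near_add_far (r := 2 * h) fun p q => (i1 p q).sub (i2 p q)]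
  have near : ‖∫ u in -(2 * h)..2 * h, E u‖
      ≤ 2 * (Real.pi * ‖f‖ * ∫ u in (0 : ℝ)..3 * h, modulusCont a u / u) := by
    rw [hE, intervalIntegral.integral_sub (i1 _ _) (i2 _ _),
      intervalIntegral.integral_comp_sub_right, two_mul (Real.pi * _ * _)]
    refine (norm_sub_le _ _).trans (add_le_add ?_ ?_)
    · exact norm_integral_near_le ha f _ hh hh' (by linarith) (by linarith) (by linarith)
    · exact norm_integral_near_le ha f t hh hh' (by linarith) (by linarith) (by linarith)
  have g1 := (((hf.mono (by linarith : 0 ≤ 2 * h) (by linarith) le_rfl).const_mul Real.pi).add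
    (intervalIntegrable_const (c := ‖f‖))).const_mul (modulusCont a h)
  have g2 := (ha.div_sq (by linarith : 0 < 2 * h) (by linarith) le_rfl).const_mul
    (4 * Real.pi ^ 2 * ‖f‖ * h)
  have far : ‖∫ u in 2 * h..Real.pi, (E u + E (-u))‖
      ≤ modulusCont a h * (Real.pi * diniIntegral f + Real.pi * ‖f‖)
        + 4 * Real.pi ^ 2 * ‖f‖ * h * ∫ u in h..Real.pi, modulusCont a u / u ^ 2 := by
    refine (intervalIntegral.norm_integral_le_of_norm_le (μ := volume) (by linarith)
      (Eventually.of_forall fun u hu => norm_far_le a f t hh hh' hu.1.le hu.2)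
      (g1.add g2)).trans ?_
    rw [intervalIntegral.integral_add g1 g2, intervalIntegral.integral_const_mul,
      intervalIntegral.integral_const_mul, intervalIntegral.integral_add
        ((hf.mono (by linarith : 0 ≤ 2 * h) (by linarith) le_rfl).const_mul Real.pi)
        intervalIntegrable_const, intervalIntegral.integral_const_mul,
      intervalIntegral.integral_const, smul_eq_mul]
    have d1 : ∫ u in 2 * h..Real.pi, modulusCont f u / u ≤ diniIntegral f := by
      refine intervalIntegral.integral_mono_interval (by linarith) (by linarith) le_rfl ?_ hf
      refine (ae_restrict_iff' measurableSet_Ioc).mpr (Eventually.of_forall fun u hu => ?_)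
      exact div_nonneg (modulusCont_nonneg _ _) hu.1.le
    have d2 : ∫ u in 2 * h..Real.pi, modulusCont a u / u ^ 2
        ≤ ∫ u in h..Real.pi, modulusCont a u / u ^ 2 :=
      intervalIntegral.integral_mono_interval (by linarith) (by linarith) le_rfl
        (Eventually.of_forall fun u => div_nonneg (modulusCont_nonneg _ _) (sq_nonneg _))
        (ha.div_sq hh (by linarith) le_rfl)
    have d3 := modulusCont_nonneg a h
    have d4 := norm_nonneg f
    gcongr
    linarith
  have trip := integral_modulusCont_triple_le ha hh hh'
  have p0 : 0 ≤ ∫ u in (0 : ℝ)..h, modulusCont a u / u :=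
    intervalIntegral.integral_nonneg hh.le fun u hu => div_nonneg (modulusCont_nonneg _ _) hu.1
  have trip' := mul_le_mul_of_nonneg_left trip
    (by positivity : 0 ≤ 2 * (Real.pi * ‖f‖))
  -- The near part yields `2π` times `∫₀ʰ` and `6π` times the tail, the far part `4π²` times the
  -- tail; this term raises the first coefficient to the common `6π + 4π²`.
  have p1 : 0 ≤ (4 * Real.pi + 4 * Real.pi ^ 2) * ‖f‖ *
      ∫ u in (0 : ℝ)..h, modulusCont a u / u := by positivity
  refine ((norm_add_le _ _).trans (add_le_add near far)).trans ?_
  rw [zygmundIntegral]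
  linarith

/-! ### Identification of the principal value -/

/-- Rotating by `t` preserves chord lengths, so the truncation set no longer depends on `t`;
periodicity restores the interval `[-π, π]`. -/
theorem truncatedCauchy_eq (φ : C(Circle, ℂ)) (t : Circle) (ε : ℝ) :
    truncatedCauchy φ t ε = 1 / (Real.pi * Complex.I) *
      ∫ u in -Real.pi..Real.pi, {u : ℝ | ε < ‖(Circle.exp u : ℂ) - 1‖}.indicator
        (fun u => φ (t * Circle.exp u) * cauchyKernel u) u := by
  obtain ⟨y, rfl⟩ : ∃ y : ℝ, Circle.exp y = t := ⟨_, Circle.exp_arg t⟩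
  set F : ℝ → ℂ := fun u => {u : ℝ | ε < ‖(Circle.exp u : ℂ) - 1‖}.indicator
        (fun u => φ (Circle.exp y * Circle.exp u) * cauchyKernel u) u with hF
  have hper : Function.Periodic F (2 * Real.pi) := fun u => by
    simp only [hF, indicator, mem_ofPred_eq, cauchyKernel, Circle.periodic_exp u]
  have key : ∀ θ : ℝ, {θ : ℝ | ε < ‖(Circle.exp θ : ℂ) - (Circle.exp y : ℂ)‖}.indicator
      (fun θ => φ (Circle.exp θ) / ((Circle.exp θ : ℂ) - (Circle.exp y : ℂ)) *
        (Complex.I * (Circle.exp θ : ℂ))) θ = F (θ - y) := by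
    intro θ
    have e1 : Circle.exp θ = Circle.exp y * Circle.exp (θ - y) := by
      rw [← Circle.exp_add, add_sub_cancel]
    have e2 : (Circle.exp θ : ℂ) - (Circle.exp y : ℂ)
        = (Circle.exp y : ℂ) * ((Circle.exp (θ - y) : ℂ) - 1) := by
      rw [e1, Circle.coe_mul]; ring
    have e3 : ‖(Circle.exp θ : ℂ) - (Circle.exp y : ℂ)‖ = ‖(Circle.exp (θ - y) : ℂ) - 1‖ := by
      rw [e2, norm_mul, Circle.norm_coe, one_mul]
    simp only [hF, indicator, mem_ofPred_eq, e3]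
    congr 1
    rw [e2, ← e1, cauchyKernel]
    have h0 : (Circle.exp y : ℂ) ≠ 0 := Circle.coe_ne_zero _
    have e4 : (Circle.exp θ : ℂ) = (Circle.exp y : ℂ) * (Circle.exp (θ - y) : ℂ) := by
      rw [e1, Circle.coe_mul]
    rw [e4, div_mul_eq_mul_div, ← mul_div_mul_left _ ((Circle.exp (θ - y) : ℂ) - 1) h0]
    ring
  have hms : MeasurableSet {θ : ℝ | ε < ‖(Circle.exp θ : ℂ) - (Circle.exp y : ℂ)‖} := by
    have : Continuous fun θ : ℝ => ‖(Circle.exp θ : ℂ) - (Circle.exp y : ℂ)‖ := by fun_prop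
    exact measurableSet_lt measurable_const this.measurable
  rw [truncatedCauchy]
  congr 1
  have hset : {θ : ℝ | θ ∈ Ioc (-Real.pi) Real.pi ∧
      ε < ‖(Circle.exp θ : ℂ) - (Circle.exp y : ℂ)‖}
      = Ioc (-Real.pi) Real.pi ∩ {θ : ℝ | ε < ‖(Circle.exp θ : ℂ) - (Circle.exp y : ℂ)‖} := rfl
  rw [hset, ← setIntegral_indicator hms, ← intervalIntegral.integral_of_le
    (by linarith [Real.pi_pos])]
  simp only [key]
  rw [intervalIntegral.integral_comp_sub_right]
  have h1 := hper.intervalIntegral_add_eq (-Real.pi - y) (-Real.pi)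
  convert h1 using 2 <;> ring

theorem tendsto_indicator_chord {u : ℝ} (h0 : u ≠ 0) (hu : |u| ≤ Real.pi) (F : ℝ → ℂ) :
    Tendsto (fun ε : ℝ => {u : ℝ | ε < ‖(Circle.exp u : ℂ) - 1‖}.indicator F u) (𝓝[>] 0)
      (𝓝 (F u)) := by
  have h1 : 0 < ‖(Circle.exp u : ℂ) - 1‖ :=
    norm_pos_iff.mpr (exp_ne_one h0 (by linarith [Real.pi_pos]))
  refine tendsto_const_nhds.congr' ?_
  filter_upwards [Ioo_mem_nhdsGT h1] with ε hε
  rw [indicator_of_mem]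
  exact hε.2

theorem measurableSet_chord (ε : ℝ) : MeasurableSet {u : ℝ | ε < ‖(Circle.exp u : ℂ) - 1‖} := by
  have : Continuous fun u : ℝ => ‖(Circle.exp u : ℂ) - 1‖ := by fun_prop
  exact measurableSet_lt measurable_const this.measurable

theorem norm_cauchyKernel_le_of_chord {ε u : ℝ} (hε : 0 < ε)
    (hu : ε < ‖(Circle.exp u : ℂ) - 1‖) : ‖cauchyKernel u‖ ≤ 1 / ε := by
  rw [cauchyKernel, norm_div, norm_mul, Complex.norm_I, Circle.norm_coe, mul_one]
  exact one_div_le_one_div_of_le hε hu.le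

theorem intervalIntegrable_truncated (φ : C(Circle, ℂ)) (t : Circle) {ε : ℝ} (hε : 0 < ε)
    (p q : ℝ) :
    IntervalIntegrable ({u : ℝ | ε < ‖(Circle.exp u : ℂ) - 1‖}.indicator
        (fun u => φ (t * Circle.exp u) * cauchyKernel u)) volume p q := by
  have hc : Continuous fun u : ℝ => φ (t * Circle.exp u) := by fun_prop
  refine IntervalIntegrable.mono_fun' (intervalIntegrable_const (c := ‖φ‖ * (1 / ε)))
    ((hc.measurable.mul measurable_cauchyKernel).indicator
      (measurableSet_chord ε)).aestronglyMeasurable (Eventually.of_forall fun u => ?_)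
  simp only [indicator]
  split_ifs with h
  · rw [norm_mul]
    exact mul_le_mul (φ.norm_coe_le_norm _) (norm_cauchyKernel_le_of_chord hε h) (norm_nonneg _)
      (norm_nonneg _)
  · rw [norm_zero]; positivity

/-- The truncation is symmetric in `u`, so folding leaves the bounded integrand `i` on the part of
`[0, π]` that survives. -/
theorem tendsto_integral_cauchyKernel :
    Tendsto (fun ε : ℝ => ∫ u in -Real.pi..Real.pi,
      {u : ℝ | ε < ‖(Circle.exp u : ℂ) - 1‖}.indicator cauchyKernel u) (𝓝[>] 0)
      (𝓝 (Real.pi * Complex.I)) := by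
  have hpi := Real.pi_pos
  have e : ∀ ε : ℝ, 0 < ε → ∫ u in -Real.pi..Real.pi,
      {u : ℝ | ε < ‖(Circle.exp u : ℂ) - 1‖}.indicator cauchyKernel u
      = ∫ u in (0 : ℝ)..Real.pi,
        {u : ℝ | ε < ‖(Circle.exp u : ℂ) - 1‖}.indicator (fun _ => Complex.I) u := by
    intro ε hε
    have hi : ∀ p q, IntervalIntegrable ({u : ℝ | ε < ‖(Circle.exp u : ℂ) - 1‖}.indicator
        cauchyKernel) volume p q := fun p q => by
      simpa using intervalIntegrable_truncated 1 1 hε p q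
    rw [intervalIntegral_eq_near_add_far (r := 0) hi, neg_zero, intervalIntegral.integral_same,
      zero_add]
    refine intervalIntegral.integral_congr fun u hu => ?_
    rw [uIcc_of_le hpi.le] at hu
    have hsymm : ‖(Circle.exp (-u) : ℂ) - 1‖ = ‖(Circle.exp u : ℂ) - 1‖ := by
      rw [norm_exp_sub_one_eq, norm_exp_sub_one_eq, neg_div, Real.sin_neg, abs_neg]
    simp only [indicator, mem_ofPred_eq, hsymm]
    split_ifs with h
    · refine cauchyKernel_add_neg ?_ (by rw [abs_of_nonneg hu.1]; exact hu.2)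
      rintro rfl
      simp at h
      linarith
    · simp
  have hlim : Tendsto (fun ε : ℝ => ∫ u in (0 : ℝ)..Real.pi,
        {u : ℝ | ε < ‖(Circle.exp u : ℂ) - 1‖}.indicator (fun _ => Complex.I) u) (𝓝[>] 0)
      (𝓝 (∫ u in (0 : ℝ)..Real.pi, Complex.I)) := by
    refine intervalIntegral.tendsto_integral_filter_of_dominated_convergence (fun _ => 1)
      (Eventually.of_forall fun ε =>
        (measurable_const.indicator (measurableSet_chord ε)).aestronglyMeasurable)
      (Eventually.of_forall fun ε => Eventually.of_forall fun u _ => ?_)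
      intervalIntegrable_const (Eventually.of_forall fun u hu => ?_)
    · exact (norm_indicator_le_norm_self _ _).trans (by simp)
    · rw [uIoc_of_le hpi.le] at hu
      exact tendsto_indicator_chord hu.1.ne' (by rw [abs_of_pos hu.1]; exact hu.2)
        (fun _ => Complex.I)
  rw [intervalIntegral.integral_const, sub_zero, Complex.real_smul] at hlim
  refine hlim.congr' ?_
  filter_upwards [self_mem_nhdsWithin] with ε hε using (e ε hε).symm

/-- Split `φ(τ) = φ(t) - (φ(t) - φ(τ))`: the constant gives `φ(t) πi` in the limit, and the rest is
absolutely integrable. -/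
theorem tendsto_truncatedCauchy {φ : C(Circle, ℂ)} (hφ : IsDini φ) (t : Circle) :
    Tendsto (truncatedCauchy φ t) (𝓝[>] 0)
      (𝓝 (φ t - 1 / (Real.pi * Complex.I) * commIntegral φ 1 t)) := by
  have hpi := Real.pi_pos
  have h1 : Tendsto (fun ε : ℝ => ∫ u in -Real.pi..Real.pi,
      {u : ℝ | ε < ‖(Circle.exp u : ℂ) - 1‖}.indicator (commIntegrand φ 1 t) u) (𝓝[>] 0)
      (𝓝 (commIntegral φ 1 t)) := by
    refine intervalIntegral.tendsto_integral_filter_of_dominated_convergence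
      (fun u => ‖commIntegrand φ 1 t u‖)
      (Eventually.of_forall fun ε =>
        ((measurable_commIntegrand φ 1 t).indicator (measurableSet_chord ε)).aestronglyMeasurable)
      (Eventually.of_forall fun ε => Eventually.of_forall fun u _ =>
        norm_indicator_le_norm_self _ _)
      (intervalIntegrable_commIntegrand hφ 1 t).norm ?_
    filter_upwards [Measure.ae_ne volume (0 : ℝ)] with u h0 hu
    exact tendsto_indicator_chord h0 (abs_le_of_mem_uIoc hpi.le hu) _
  have h2 := tendsto_integral_cauchyKernel.const_mul (φ t)
  have h3 := (h2.sub h1).const_mul (1 / (Real.pi * Complex.I))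
  have hne : (Real.pi : ℂ) * Complex.I ≠ 0 :=
    mul_ne_zero (by exact_mod_cast hpi.ne') Complex.I_ne_zero
  have hval : 1 / (Real.pi * Complex.I) * (φ t * (Real.pi * Complex.I) - commIntegral φ 1 t)
      = φ t - 1 / (Real.pi * Complex.I) * commIntegral φ 1 t := by
    field_simp
  rw [hval] at h3
  refine h3.congr' ?_
  filter_upwards [self_mem_nhdsWithin] with ε hε
  have hi1 : IntervalIntegrable ({u : ℝ | ε < ‖(Circle.exp u : ℂ) - 1‖}.indicator
      cauchyKernel) volume (-Real.pi) Real.pi := by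
    simpa using intervalIntegrable_truncated 1 1 hε (-Real.pi) Real.pi
  have hi2 : IntervalIntegrable ({u : ℝ | ε < ‖(Circle.exp u : ℂ) - 1‖}.indicator
      (commIntegrand φ 1 t)) volume (-Real.pi) Real.pi := by
    refine IntervalIntegrable.mono_fun (intervalIntegrable_commIntegrand hφ 1 t)
      ((measurable_commIntegrand φ 1 t).indicator (measurableSet_chord ε)).aestronglyMeasurable
      (Eventually.of_forall fun u => norm_indicator_le_norm_self _ _)
  rw [truncatedCauchy_eq, ← intervalIntegral.integral_const_mul,
    ← intervalIntegral.integral_sub (hi1.const_mul _) hi2]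
  congr 1
  refine intervalIntegral.integral_congr fun u _ => ?_
  simp only [indicator, commIntegrand, ContinuousMap.one_apply]
  split_ifs
  · ring
  · ring

/-! ### Functions of the Bari-Stechkin class -/

namespace BariStechkin

variable (ω : BariStechkin)

theorem intervalIntegrable_div : IntervalIntegrable (fun y => ω y / y) volume 0 Real.pi :=
  (intervalIntegrable_iff_integrableOn_Ioc_of_le Real.pi_pos.le).mpr ω.integrable

theorem intervalIntegrable_div_sq {x z : ℝ} (hx : 0 < x) (hxz : x ≤ z) (hz : z ≤ Real.pi) :
    IntervalIntegrable (fun y => ω y / y ^ 2) volume x z := by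
  have h0 : IntervalIntegrable (fun y => ω y / y) volume x z := by
    refine IntervalIntegrable.mono_set ω.intervalIntegrable_div ?_
    rw [uIcc_of_le hxz, uIcc_of_le Real.pi_pos.le]
    exact Icc_subset_Icc hx.le hz
  have h := h0.mul_continuousOn (g := fun u => u⁻¹) (by
    rw [uIcc_of_le hxz]
    exact continuousOn_id.inv₀ fun u hu => (hx.trans_le hu.1).ne')
  refine h.congr (fun u _ => ?_)
  simp only [div_eq_mul_inv, sq, mul_inv, mul_assoc]

theorem exists_bound : ∃ C : ℝ, 0 < C ∧ ∀ x ∈ Ioc 0 Real.pi,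
    (∫ y in (0 : ℝ)..x, ω y / y) ≤ C * ω x ∧ x * (∫ y in x..Real.pi, ω y / y ^ 2) ≤ C * ω x := by
  obtain ⟨C₀, h₀⟩ := ω.bound_zero
  obtain ⟨C₁, h₁⟩ := ω.bound_pi
  refine ⟨max 1 (max C₀ C₁), by positivity, fun x hx => ?_⟩
  have hω := ω.pos x hx
  have e0 := h₀ x hx
  have e1 := h₁ x hx
  rw [← intervalIntegral.integral_of_le hx.1.le] at e0
  rw [← intervalIntegral.integral_of_le hx.2] at e1
  have m0 : C₀ ≤ max 1 (max C₀ C₁) := (le_max_left _ _).trans (le_max_right _ _)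
  have m1 : C₁ ≤ max 1 (max C₀ C₁) := (le_max_right _ _).trans (le_max_right _ _)
  constructor
  · rw [← div_le_iff₀ hω]
    refine (le_of_eq ?_).trans (e0.trans m0)
    ring
  · rw [← div_le_iff₀ hω]
    refine (le_of_eq ?_).trans (e1.trans m1)
    ring

theorem exists_almostIncreasing : ∃ A : ℝ, 0 < A ∧ ∀ x y : ℝ, 0 < x → x ≤ y → y ≤ Real.pi →
    ω x ≤ A * ω y := by
  obtain ⟨A, hA, h⟩ := ω.almostIncreasing
  exact ⟨A, hA, fun x y hx hxy hy =>
    h x ⟨hx, hxy.trans hy⟩ y ⟨hx.trans_le hxy, hy⟩ hxy⟩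

/-- In the second integral condition, `∫ₓ^π` is at least the fixed positive number `∫_{π/2}^π`. -/
theorem exists_linear_le : ∃ c : ℝ, 0 < c ∧ ∀ x : ℝ, 0 < x → x ≤ Real.pi / 2 → c * x ≤ ω x := by
  have hpi := Real.pi_pos
  obtain ⟨C, hC, hb⟩ := ω.exists_bound
  have J0 : 0 < ∫ y in (Real.pi / 2)..Real.pi, ω y / y ^ 2 :=
    intervalIntegral.intervalIntegral_pos_of_pos_on
      (ω.intervalIntegrable_div_sq (by linarith) (by linarith) le_rfl)
      (fun y hy => div_pos (ω.pos y ⟨by linarith [hy.1], hy.2.le⟩)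
        (pow_pos (by linarith [hy.1]) 2)) (by linarith)
  refine ⟨(∫ y in (Real.pi / 2)..Real.pi, ω y / y ^ 2) / C, by positivity, fun x hx hx' => ?_⟩
  have h1 := (hb x ⟨hx, by linarith⟩).2
  have h2 : ∫ y in (Real.pi / 2)..Real.pi, ω y / y ^ 2 ≤ ∫ y in x..Real.pi, ω y / y ^ 2 := by
    refine intervalIntegral.integral_mono_interval hx' (by linarith) le_rfl ?_
      (ω.intervalIntegrable_div_sq hx (by linarith) le_rfl)
    refine (ae_restrict_iff' measurableSet_Ioc).mpr (Eventually.of_forall fun y hy => ?_)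
    exact div_nonneg (ω.pos y ⟨hx.trans hy.1, hy.2⟩).le (sq_nonneg _)
  rw [div_mul_eq_mul_div, div_le_iff₀ hC]
  have h3 := mul_le_mul_of_nonneg_left h2 hx.le
  linarith

/-- Bootstrapping: inserting the linear lower bound `c y ≤ ω(y)` into the second integral condition
gives `C ω(x)/x ≥ c log(π/(2x))`, which is unbounded. -/
theorem tendsto_div_self : Tendsto (fun x => x / ω x) (𝓝[>] 0) (𝓝 0) := by
  have hpi := Real.pi_pos
  obtain ⟨C, hC, hb⟩ := ω.exists_bound
  obtain ⟨c, hc, hl⟩ := ω.exists_linear_le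
  have hlog : Tendsto (fun x : ℝ => c * (Real.log (Real.pi / 2) - Real.log x)) (𝓝[>] 0) atTop :=
    (tendsto_atTop_add_const_left _ _
      (tendsto_neg_atBot_atTop.comp Real.tendsto_log_nhdsGT_zero)).const_mul_atTop hc
  have hlim := hlog.const_div_atTop C
  have hI : Ioo 0 (Real.pi / 2) ∈ 𝓝[>] (0 : ℝ) := Ioo_mem_nhdsGT (by linarith)
  refine squeeze_zero' ?_ ?_ hlim
  · filter_upwards [hI] with x hx
    exact div_nonneg hx.1.le (ω.pos x ⟨hx.1, by linarith [hx.2]⟩).le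
  · filter_upwards [hI] with x hx
    have hω := ω.pos x ⟨hx.1, by linarith [hx.2]⟩
    have hlt : 0 < Real.log (Real.pi / 2) - Real.log x :=
      sub_pos.mpr (Real.log_lt_log hx.1 hx.2)
    have h1 := (hb x ⟨hx.1, by linarith [hx.2]⟩).2
    have h2 : ∫ y in x..Real.pi / 2, ω y / y ^ 2 ≤ ∫ y in x..Real.pi, ω y / y ^ 2 := by
      refine intervalIntegral.integral_mono_interval le_rfl hx.2.le (by linarith) ?_
        (ω.intervalIntegrable_div_sq hx.1 (by linarith [hx.2]) le_rfl)
      refine (ae_restrict_iff' measurableSet_Ioc).mpr (Eventually.of_forall fun y hy => ?_)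
      exact div_nonneg (ω.pos y ⟨hx.1.trans hy.1, hy.2⟩).le (sq_nonneg _)
    have h3 : ∫ y in x..Real.pi / 2, c * y⁻¹ ≤ ∫ y in x..Real.pi / 2, ω y / y ^ 2 := by
      refine intervalIntegral.integral_mono_on hx.2.le ?_
        (ω.intervalIntegrable_div_sq hx.1 hx.2.le (by linarith)) fun y hy => ?_
      · refine ContinuousOn.intervalIntegrable ?_
        rw [uIcc_of_le hx.2.le]
        exact continuousOn_const.mul
          (continuousOn_id.inv₀ fun u hu => (hx.1.trans_le hu.1).ne')
      · have hy0 : 0 < y := hx.1.trans_le hy.1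
        have h4 := hl y hy0 hy.2
        rw [le_div_iff₀ (by positivity)]
        refine le_trans (le_of_eq ?_) h4
        field_simp
    rw [intervalIntegral.integral_const_mul, integral_inv_of_pos hx.1 (by linarith),
      Real.log_div (by positivity) hx.1.ne'] at h3
    rw [div_le_div_iff₀ hω (by positivity)]
    exact (mul_le_mul_of_nonneg_left (h3.trans h2) hx.1.le).trans h1

end BariStechkin

/-! ### Moduli of continuity majorized by `ε ω(u) + c u²`. -/

theorem measurable_modulusCont (a : C(Circle, ℂ)) : Measurable (modulusCont a) :=
  (modulusCont_mono a).measurable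

theorem isDini_of_le (ω : BariStechkin) {a : C(Circle, ℂ)} {ε c : ℝ}
    (ha : ∀ u ∈ Ioc 0 Real.pi, modulusCont a u ≤ ε * ω u + c * u ^ 2) : IsDini a := by
  have hid : IntervalIntegrable (fun u : ℝ => c * u) volume 0 Real.pi :=
    (by fun_prop : Continuous fun u : ℝ => c * u).intervalIntegrable _ _
  refine IntervalIntegrable.mono_fun' ((ω.intervalIntegrable_div.const_mul ε).add hid)
    ((measurable_modulusCont a).div measurable_id).aestronglyMeasurable ?_
  refine (ae_restrict_iff' measurableSet_uIoc).mpr (Eventually.of_forall fun u hu => ?_)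
  rw [uIoc_of_le Real.pi_pos.le] at hu
  have h0 := hu.1
  beta_reduce
  rw [Real.norm_of_nonneg (div_nonneg (modulusCont_nonneg _ _) h0.le), div_le_iff₀ h0]
  refine (ha u hu).trans (le_of_eq ?_)
  field_simp

theorem zygmundIntegral_nonneg (a : C(Circle, ℂ)) {h : ℝ} (hh : h ∈ Ioc 0 Real.pi) :
    0 ≤ zygmundIntegral a h :=
  add_nonneg (intervalIntegral.integral_nonneg hh.1.le fun _ hu =>
      div_nonneg (modulusCont_nonneg _ _) hu.1)
    (mul_nonneg hh.1.le (intervalIntegral.integral_nonneg hh.2 fun _ _ =>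
      div_nonneg (modulusCont_nonneg _ _) (sq_nonneg _)))

/-- The integral conditions handle `ε ω`. The correction is quadratic because `u²/u²` integrates to
a bounded tail, hence `O(h)`; a linear correction would give `h log(1/h)`. -/
theorem exists_zygmundIntegral_le (ω : BariStechkin) : ∃ C : ℝ, 0 < C ∧
    ∀ (a : C(Circle, ℂ)) (ε c : ℝ), 0 ≤ ε → 0 ≤ c →
      (∀ u ∈ Ioc 0 Real.pi, modulusCont a u ≤ ε * ω u + c * u ^ 2) →
      ∀ h ∈ Ioc 0 Real.pi, zygmundIntegral a h ≤ C * (ε * ω h + c * h) := by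
  have hpi := Real.pi_pos
  obtain ⟨C, hC, hb⟩ := ω.exists_bound
  refine ⟨2 * C + 2 * Real.pi, by positivity, fun a ε c hε hc ha h hh => ?_⟩
  have hD := isDini_of_le ω ha
  obtain ⟨b0, b1⟩ := hb h hh
  have h0 := hh.1
  have i1 : IntervalIntegrable (fun u => ε * (ω u / u)) volume 0 h := by
    refine (IntervalIntegrable.mono_set ω.intervalIntegrable_div ?_).const_mul ε
    rw [uIcc_of_le h0.le, uIcc_of_le hpi.le]
    exact Icc_subset_Icc le_rfl hh.2
  have i2 : IntervalIntegrable (fun _ : ℝ => c * h) volume 0 h := intervalIntegrable_const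
  have i3 := (ω.intervalIntegrable_div_sq h0 hh.2 le_rfl).const_mul ε
  have i4 : IntervalIntegrable (fun _ : ℝ => c) volume h Real.pi := intervalIntegrable_const
  have j1 : ∫ u in (0 : ℝ)..h, modulusCont a u / u
      ≤ ε * (∫ u in (0 : ℝ)..h, ω u / u) + c * h * h := by
    have := intervalIntegral.integral_mono_on_of_le_Ioo h0.le (hD.mono le_rfl h0.le hh.2)
      (i1.add i2) fun u hu => by
        have hu0 := hu.1
        have h1 := ha u ⟨hu.1, hu.2.le.trans hh.2⟩
        rw [div_le_iff₀ hu0]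
        have e : (ε * (ω u / u) + c * h) * u = ε * ω u + c * (h * u) := by field_simp
        rw [e]
        have h2 : c * u ^ 2 ≤ c * (h * u) := by
          rw [sq]
          exact mul_le_mul_of_nonneg_left (mul_le_mul_of_nonneg_right hu.2.le hu0.le) hc
        linarith
    rwa [intervalIntegral.integral_add i1 i2, intervalIntegral.integral_const_mul,
      intervalIntegral.integral_const, smul_eq_mul, sub_zero, mul_comm h] at this
  have j2 : ∫ u in h..Real.pi, modulusCont a u / u ^ 2
      ≤ ε * (∫ u in h..Real.pi, ω u / u ^ 2) + c * Real.pi := by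
    have := intervalIntegral.integral_mono_on hh.2 (hD.div_sq h0 hh.2 le_rfl)
      (i3.add i4) fun u hu => by
        have hu0 : 0 < u := h0.trans_le hu.1
        have h1 := ha u ⟨hu0, hu.2⟩
        rw [div_le_iff₀ (by positivity)]
        refine h1.trans (le_of_eq ?_)
        field_simp
    rw [intervalIntegral.integral_add i3 i4, intervalIntegral.integral_const_mul,
      intervalIntegral.integral_const, smul_eq_mul] at this
    refine this.trans ?_
    have : (Real.pi - h) * c ≤ Real.pi * c := by gcongr; linarith
    linarith
  have k1 := mul_le_mul_of_nonneg_left b0 hε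
  have k2 := mul_le_mul_of_nonneg_left b1 hε
  have k3 := mul_le_mul_of_nonneg_left j2 h0.le
  have k4 : c * h * h ≤ c * h * Real.pi := mul_le_mul_of_nonneg_left hh.2 (by positivity)
  have k5 : 0 ≤ C * (c * h) := by positivity
  have k6 : 0 ≤ Real.pi * (ε * ω h) := by have := ω.pos h hh; positivity
  rw [zygmundIntegral]
  linarith

/-! ### Estimates of the singular integral in generalized Hölder spaces -/

/-- Used twice: with `c = 0` and `ε` the seminorm of `a` for `H^ω`, and with `ε` arbitrarily small
for `H_0^ω`. -/
theorem exists_modulusCont_commIntegral_le_of_small (ω : BariStechkin) : ∃ K : ℝ, 0 < K ∧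
    ∀ (a f : C(Circle, ℂ)) (ε c : ℝ), 0 ≤ ε → 0 ≤ c → IsDini f →
      (∀ u ∈ Ioc 0 Real.pi, modulusCont a u ≤ ε * ω u + c * u ^ 2) →
      ∀ (h y : ℝ), 0 < h → h ≤ Real.pi / 3 →
        ‖commIntegral a f (Circle.exp (y + h)) - commIntegral a f (Circle.exp y)‖
          ≤ K * (‖f‖ + diniIntegral f) * (ε * ω h + c * h) := by
  have hpi := Real.pi_pos
  obtain ⟨C, hC, hz⟩ := exists_zygmundIntegral_le ω
  refine ⟨(6 * Real.pi + 4 * Real.pi ^ 2) * C + Real.pi * (1 + Real.pi), by positivity,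
    fun a f ε c hε hc hf ha h y hh hh' => ?_⟩
  have hm : h ∈ Ioc 0 Real.pi := ⟨hh, by linarith⟩
  have h1 := norm_commIntegral_sub_le (isDini_of_le ω ha) hf (Circle.exp y) hh hh'
  rw [← Circle.exp_add] at h1
  have h2 := hz a ε c hε hc ha h hm
  have h3 := ha h hm
  have hω := ω.pos h hm
  have hd := diniIntegral_nonneg f
  have hn := norm_nonneg f
  have h4 : modulusCont a h ≤ (1 + Real.pi) * (ε * ω h + c * h) := by
    have e1 : c * h ^ 2 ≤ c * h * Real.pi := by
      rw [sq, ← mul_assoc]; exact mul_le_mul_of_nonneg_left hm.2 (by positivity)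
    have e2 : 0 ≤ Real.pi * (ε * ω h) := by positivity
    have e3 : 0 ≤ c * h := by positivity
    linarith
  refine h1.trans ?_
  calc _ ≤ (6 * Real.pi + 4 * Real.pi ^ 2) * (‖f‖ + diniIntegral f) * (C * (ε * ω h + c * h))
        + Real.pi * ((1 + Real.pi) * (ε * ω h + c * h)) * (diniIntegral f + ‖f‖) := by
        gcongr
        · exact zygmundIntegral_nonneg a hm
        · linarith
    _ = _ := by ring

theorem exists_commIntegral_le (ω : BariStechkin) : ∃ K : ℝ, 0 < K ∧
    ∀ (a f : C(Circle, ℂ)) (M : ℝ), 0 ≤ M → IsDini f →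
      (∀ u ∈ Ioc 0 Real.pi, modulusCont a u ≤ M * ω u) →
      (∀ t, ‖commIntegral a f t‖ ≤ K * M * (‖f‖ + diniIntegral f)) ∧
      ∀ x ∈ Ioc 0 Real.pi,
        modulusCont (commIntegral a f) x ≤ K * M * (‖f‖ + diniIntegral f) * ω x := by
  have hpi := Real.pi_pos
  obtain ⟨K₁, hK₁, h₁⟩ := exists_modulusCont_commIntegral_le_of_small ω
  obtain ⟨A, hA, hinc⟩ := ω.exists_almostIncreasing
  set I := ∫ u in (0 : ℝ)..Real.pi, ω u / u with hI
  have hI0 : 0 ≤ I := by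
    rw [hI, intervalIntegral.integral_of_le hpi.le]
    exact setIntegral_nonneg measurableSet_Ioc fun u hu =>
      div_nonneg (ω.pos u hu).le hu.1.le
  have hω3 := ω.pos (Real.pi / 3) ⟨by positivity, by linarith⟩
  refine ⟨Real.pi * I + K₁ * A + 2 * (Real.pi * I) * A / ω (Real.pi / 3), by positivity,
    fun a f M hM hf ha => ?_⟩
  have ha' : ∀ u ∈ Ioc 0 Real.pi, modulusCont a u ≤ M * ω u + 0 * u ^ 2 := by simpa using ha
  have hD := isDini_of_le ω ha'
  have hd := diniIntegral_nonneg f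
  have hn := norm_nonneg f
  have hda : diniIntegral a ≤ M * I := by
    rw [hI, ← intervalIntegral.integral_const_mul]
    refine intervalIntegral.integral_mono_on_of_le_Ioo hpi.le hD
      (ω.intervalIntegrable_div.const_mul M) fun u hu => ?_
    rw [mul_div_assoc']
    have hu1 := hu.1
    have := ha u ⟨hu.1, hu.2.le⟩
    gcongr
  have hsup : ∀ t, ‖commIntegral a f t‖ ≤ Real.pi * I * M * (‖f‖ + diniIntegral f) := fun t => by
    refine (norm_commIntegral_le hD f t).trans ?_
    calc _ ≤ Real.pi * (‖f‖ + diniIntegral f) * (M * I) := by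
          gcongr
          · exact diniIntegral_nonneg a
          · linarith
      _ = _ := by ring
  refine ⟨fun t => (hsup t).trans ?_, fun x hx => ?_⟩
  · gcongr
    have : 0 ≤ K₁ * A + 2 * (Real.pi * I) * A / ω (Real.pi / 3) := by positivity
    linarith
  · have hω := ω.pos x hx
    refine modulusCont_le_of_pos (by positivity) fun h y hh hhx => ?_
    -- Large steps need only the sup bound, since almost monotonicity keeps `ω(x)` above `ω(π/3)/A`.
    rcases le_or_gt h (Real.pi / 3) with h3 | h3
    · have e := h₁ a f M 0 hM le_rfl hf ha' h y hh h3
      have e2 := hinc h x hh hhx hx.2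
      refine e.trans ?_
      rw [zero_mul, add_zero]
      calc _ ≤ K₁ * (‖f‖ + diniIntegral f) * (M * (A * ω x)) := by gcongr
        _ = K₁ * A * M * (‖f‖ + diniIntegral f) * ω x := by ring
        _ ≤ _ := by
          gcongr
          have : 0 ≤ Real.pi * I + 2 * (Real.pi * I) * A / ω (Real.pi / 3) := by positivity
          linarith
    · have e2 := hinc (Real.pi / 3) x (by positivity) (h3.le.trans hhx) hx.2
      have e3 : 1 ≤ A / ω (Real.pi / 3) * ω x := by
        rw [div_mul_eq_mul_div, le_div_iff₀ hω3]; linarith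
      have e1 : ‖commIntegral a f (Circle.exp (y + h)) - commIntegral a f (Circle.exp y)‖
          ≤ 2 * (Real.pi * I * M * (‖f‖ + diniIntegral f)) := by
        refine (norm_sub_le _ _).trans ?_
        linarith [hsup (Circle.exp (y + h)), hsup (Circle.exp y)]
      refine e1.trans ?_
      calc _ ≤ 2 * (Real.pi * I * M * (‖f‖ + diniIntegral f)) * (A / ω (Real.pi / 3) * ω x) :=
            le_mul_of_one_le_right (by positivity) e3
        _ = 2 * (Real.pi * I) * A / ω (Real.pi / 3) * M * (‖f‖ + diniIntegral f) * ω x := by ring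
        _ ≤ _ := by
          gcongr
          have : 0 ≤ Real.pi * I + K₁ * A := by positivity
          linarith

/-! ### Invertibility -/

/-- From `1/a - 1/b = (b - a)/(ab)`, with `C = ‖1/a‖²`. Bounding the modulus pointwise in `x` serves
both `H^ω` and `H_0^ω`. -/
theorem exists_inverse_modulusCont_le (a : C(Circle, ℂ)) (ha : ∀ t, a t ≠ 0) :
    ∃ g : C(Circle, ℂ), a * g = 1 ∧
      ∃ C : ℝ, 0 ≤ C ∧ ∀ x, modulusCont g x ≤ C * modulusCont a x := by
  let g : C(Circle, ℂ) := ⟨fun t => (a t)⁻¹, a.continuous.inv₀ ha⟩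
  have hg : ∀ t, a t * g t = 1 := fun t => mul_inv_cancel₀ (ha t)
  refine ⟨g, ContinuousMap.ext hg, ‖g‖ * ‖g‖, by positivity, fun x => ?_⟩
  refine modulusCont_le (mul_nonneg (by positivity) (modulusCont_nonneg _ _)) fun h y hh => ?_
  have e : g (Circle.exp (y + h)) - g (Circle.exp y)
      = g (Circle.exp (y + h)) * g (Circle.exp y)
        * (a (Circle.exp y) - a (Circle.exp (y + h))) := by
    linear_combination g (Circle.exp y) * hg (Circle.exp (y + h))
      - g (Circle.exp (y + h)) * hg (Circle.exp y)
  have m := le_modulusCont a hh y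
  rw [norm_sub_rev] at m
  rw [e, norm_mul, norm_mul]
  gcongr
  · exact g.norm_coe_le_norm _
  · exact g.norm_coe_le_norm _

namespace HolderSpace

variable {ω : BariStechkin}

@[ext] theorem ext {f g : HolderSpace ω} (h : ∀ t, f t = g t) : f = g :=
  Subtype.ext (ContinuousMap.ext h)

theorem add_apply (f g : HolderSpace ω) (t : Circle) : (f + g) t = f t + g t := rfl

theorem sub_apply (f g : HolderSpace ω) (t : Circle) : (f - g) t = f t - g t := rfl

theorem mul_apply (f g : HolderSpace ω) (t : Circle) : (f * g) t = f t * g t := rfl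

theorem one_apply (t : Circle) : (1 : HolderSpace ω) t = 1 := rfl

theorem smul_apply (c : ℂ) (f : HolderSpace ω) (t : Circle) : (c • f) t = c * f t := rfl

theorem modulusCont_le (f : HolderSpace ω) {u : ℝ} (hu : u ∈ Ioc 0 Real.pi) :
    modulusCont f u ≤ holderSeminorm ω f * ω u :=
  (div_le_iff₀ (ω.pos u hu)).mp (le_holderSeminorm f.bdd hu)

theorem isDini (f : HolderSpace ω) : IsDini f.toC :=
  isDini_of_le ω (ε := holderSeminorm ω f) (c := 0) fun u hu => by simpa using f.modulusCont_le hu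

theorem exists_inverse (a : HolderSpace ω) (ha : ∀ t, a t ≠ 0) :
    ∃ g : HolderSpace ω, a * g = 1 ∧ ∃ C : ℝ, 0 ≤ C ∧ ∀ x, modulusCont g x ≤ C * modulusCont a x := by
  obtain ⟨g, hg, C, hC, hm⟩ := exists_inverse_modulusCont_le a.toC ha
  refine ⟨⟨g, C * holderSeminorm ω a, ?_⟩, Subtype.ext hg, C, hC, hm⟩
  rintro r ⟨x, hx, rfl⟩
  have h1 := mul_le_mul_of_nonneg_left (a.modulusCont_le hx) hC
  exact (div_le_iff₀ (ω.pos x hx)).mpr (((hm x).trans h1).trans (by rw [mul_assoc]))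

theorem apply_ne_zero_of_isUnit {a : HolderSpace ω} (ha : IsUnit a) (t : Circle) : a t ≠ 0 := by
  obtain ⟨b, hb⟩ := ha.exists_right_inv
  have h : a t * b t = 1 := by rw [← mul_apply, hb, one_apply]
  exact left_ne_zero_of_mul_eq_one h

theorem isUnit_iff (a : HolderSpace ω) : IsUnit a ↔ ∀ t : Circle, a t ≠ 0 := by
  refine ⟨apply_ne_zero_of_isUnit, fun ha => ?_⟩
  obtain ⟨g, hg, -⟩ := a.exists_inverse ha
  exact IsUnit.of_mul_eq_one g hg

/-! ### The singular integral on the generalized Hölder space -/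

/-- The function `t ↦ ∫ (a(t) - a(τ)) f(τ) / (τ - t) dτ` as an element of `H^ω`. -/
noncomputable def comm (a : HolderSpace ω) (f : C(Circle, ℂ)) (hf : IsDini f) : HolderSpace ω :=
  ⟨⟨commIntegral a.toC f, continuous_commIntegral a.isDini f⟩, by
    obtain ⟨K, hK, h⟩ := exists_commIntegral_le ω
    refine ⟨K * holderSeminorm ω a * (‖f‖ + diniIntegral f), ?_⟩
    rintro r ⟨x, hx, rfl⟩
    exact (div_le_iff₀ (ω.pos x hx)).mpr
      ((h a.toC f _ (holderSeminorm_nonneg _ _) hf fun u hu => a.modulusCont_le hu).2 x hx)⟩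

theorem comm_apply (a : HolderSpace ω) (f : C(Circle, ℂ)) (hf : IsDini f) (t : Circle) :
    comm a f hf t = commIntegral a.toC f t := rfl

/-- The asymmetry is the point: the full norm of `H^ω` is spent on `a` alone, and the weaker
dependence on `f` is what produces compactness. -/
theorem exists_norm_comm_le (ω : BariStechkin) : ∃ K : ℝ, 0 < K ∧
    ∀ (a : HolderSpace ω) (f : C(Circle, ℂ)) (hf : IsDini f),
      ‖comm a f hf‖ ≤ K * ‖a‖ * (‖f‖ + diniIntegral f) := by
  obtain ⟨K, hK, h⟩ := exists_commIntegral_le ω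
  refine ⟨2 * K, by positivity, fun a f hf => ?_⟩
  have hs := holderSeminorm_nonneg ω a
  have hd := diniIntegral_nonneg f
  obtain ⟨h1, h2⟩ := h a.toC f _ hs hf fun u hu => a.modulusCont_le hu
  have n1 : ‖(comm a f hf).toC‖ ≤ K * holderSeminorm ω a * (‖f‖ + diniIntegral f) :=
    (ContinuousMap.norm_le _ (by positivity)).mpr h1
  have n2 : holderSeminorm ω (comm a f hf).toC
      ≤ K * holderSeminorm ω a * (‖f‖ + diniIntegral f) := by
    refine Real.sSup_le ?_ (by positivity)
    rintro r ⟨x, hx, rfl⟩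
    exact (div_le_iff₀ (ω.pos x hx)).mpr (h2 x hx)
  have n3 : holderSeminorm ω a ≤ ‖a‖ := by
    rw [norm_def]; linarith [norm_nonneg a.toC]
  rw [norm_def (comm a f hf)]
  calc _ ≤ 2 * (K * holderSeminorm ω a * (‖f‖ + diniIntegral f)) := by linarith
    _ ≤ 2 * (K * ‖a‖ * (‖f‖ + diniIntegral f)) := by gcongr
    _ = _ := by ring

end HolderSpace

/-! ### Linearity of the singular integral in each argument and the commutator identity. -/

theorem commIntegral_add_left {a b : C(Circle, ℂ)} (ha : IsDini a) (hb : IsDini b)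
    (f : C(Circle, ℂ)) (t : Circle) :
    commIntegral (a + b) f t = commIntegral a f t + commIntegral b f t := by
  rw [commIntegral, commIntegral, commIntegral, ← intervalIntegral.integral_add
    (intervalIntegrable_commIntegrand ha f t) (intervalIntegrable_commIntegrand hb f t)]
  congr 1
  ext u
  simp only [commIntegrand, ContinuousMap.add_apply]
  ring

theorem commIntegral_smul_left (c : ℂ) (a f : C(Circle, ℂ)) (t : Circle) :
    commIntegral (c • a) f t = c * commIntegral a f t := by
  rw [commIntegral, commIntegral, ← intervalIntegral.integral_const_mul]
  congr 1
  ext u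
  simp only [commIntegrand, ContinuousMap.smul_apply, smul_eq_mul]
  ring

theorem commIntegral_sub_right {a : C(Circle, ℂ)} (ha : IsDini a) (f g : C(Circle, ℂ))
    (t : Circle) : commIntegral a (f - g) t = commIntegral a f t - commIntegral a g t := by
  rw [commIntegral, commIntegral, commIntegral, ← intervalIntegral.integral_sub
    (intervalIntegrable_commIntegrand ha f t) (intervalIntegrable_commIntegrand ha g t)]
  congr 1
  ext u
  simp only [commIntegrand, ContinuousMap.sub_apply]
  ring

/-- Under the integral, `(af)(t) - (af)(τ) - a(t)(f(t) - f(τ)) = (a(t) - a(τ)) f(τ)`. -/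
theorem commIntegral_mul_one {a f : C(Circle, ℂ)} (hf : IsDini f) (haf : IsDini (a * f))
    (t : Circle) :
    commIntegral (a * f) 1 t - a t * commIntegral f 1 t = commIntegral a f t := by
  rw [commIntegral, commIntegral, commIntegral, ← intervalIntegral.integral_const_mul,
    ← intervalIntegral.integral_sub (intervalIntegrable_commIntegrand haf 1 t)
      ((intervalIntegrable_commIntegrand hf 1 t).const_mul _)]
  congr 1
  ext u
  simp only [commIntegrand, ContinuousMap.mul_apply, ContinuousMap.one_apply]
  ring

theorem isDini_one : IsDini (1 : C(Circle, ℂ)) := by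
  have h : ∀ x, modulusCont (1 : C(Circle, ℂ)) x = 0 := fun x => by
    have := modulusCont_const 1 x
    rwa [map_one] at this
  simp only [IsDini, h, zero_div]
  exact intervalIntegrable_const

theorem IsDini.sub {f g : C(Circle, ℂ)} (hf : IsDini f) (hg : IsDini g) : IsDini (f - g) := by
  refine IntervalIntegrable.mono_fun' (IntervalIntegrable.add hf hg)
    ((measurable_modulusCont _).div measurable_id).aestronglyMeasurable ?_
  refine (ae_restrict_iff' measurableSet_uIoc).mpr (Eventually.of_forall fun u hu => ?_)
  rw [uIoc_of_le Real.pi_pos.le] at hu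
  have h0 := hu.1
  beta_reduce
  have h1 := modulusCont_add_le f (-g) u
  rw [modulusCont_neg, ← sub_eq_add_neg] at h1
  rw [Real.norm_of_nonneg (div_nonneg (modulusCont_nonneg _ _) h0.le), ← add_div]
  gcongr

namespace HolderSpace

variable {ω : BariStechkin}

/-- The Cauchy singular integral operator on `H^ω`. -/
noncomputable def cauchyOp (ω : BariStechkin) : HolderSpace ω →L[ℂ] HolderSpace ω :=
  LinearMap.mkContinuousOfExistsBound
    { toFun := fun f => f - (1 / (Real.pi * Complex.I) : ℂ) • comm f 1 isDini_one
      map_add' := fun f g => by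
        ext t
        have h : commIntegral (f + g).toC 1 t = _ :=
          commIntegral_add_left f.isDini g.isDini 1 t
        simp only [sub_apply, add_apply, smul_apply, comm_apply, h]
        ring
      map_smul' := fun c f => by
        ext t
        have h : commIntegral (c • f).toC 1 t = _ := commIntegral_smul_left c f.toC 1 t
        simp only [sub_apply, smul_apply, comm_apply, h, RingHom.id_apply]
        ring }
    (by
      obtain ⟨K, hK, h⟩ := exists_norm_comm_le ω
      refine ⟨1 + ‖(1 / (Real.pi * Complex.I) : ℂ)‖
        * (K * (‖(1 : C(Circle, ℂ))‖ + diniIntegral 1)), fun f => ?_⟩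
      refine (norm_sub_le _ _).trans ?_
      have h1 := norm_smul_le (1 / (Real.pi * Complex.I) : ℂ) (comm f 1 isDini_one)
      have h2 := mul_le_mul_of_nonneg_left (h f 1 isDini_one)
        (norm_nonneg (1 / (Real.pi * Complex.I) : ℂ))
      linarith)

theorem cauchyOp_eq (f : HolderSpace ω) :
    cauchyOp ω f = f - (1 / (Real.pi * Complex.I) : ℂ) • comm f 1 isDini_one := rfl

theorem isCauchySingularIntegral_cauchyOp (f : HolderSpace ω) :
    IsCauchySingularIntegral f (cauchyOp ω f) := fun t => by
  rw [cauchyOp_eq, sub_apply, smul_apply, comm_apply]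
  exact tendsto_truncatedCauchy f.isDini t

theorem commutator_eq (a f : HolderSpace ω) :
    a * cauchyOp ω f - cauchyOp ω (a * f)
      = (1 / (Real.pi * Complex.I) : ℂ) • comm a f.toC f.isDini := by
  ext t
  have h := commIntegral_mul_one (a := a.toC) f.isDini (a * f).isDini t
  simp only [cauchyOp_eq, sub_apply, mul_apply, smul_apply, comm_apply, ← h]
  have e : (a * f).toC = a.toC * f.toC := rfl
  rw [e]
  ring

end HolderSpace

/-! ### Compactness of the commutator -/

/-- The functions of sup norm at most one whose modulus of continuity is majorized by `ω`. -/
def holderBall (ω : BariStechkin) : Set C(Circle, ℂ) :=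
  {f | ‖f‖ ≤ 1 ∧ ∀ x ∈ Ioc 0 Real.pi, modulusCont f x ≤ ω x}

/-- The neighbourhood is chosen before `g`, which gives equicontinuity. Continuity of `g` is not
assumed, so the lemma also shows that pointwise limits are continuous. -/
theorem eventually_norm_sub_lt_of_majorant (ω : BariStechkin) (t : Circle) {ε : ℝ} (hε : 0 < ε) :
    ∀ᶠ s in 𝓝 t, ∀ g : Circle → ℂ,
      (∀ x ∈ Ioc 0 Real.pi, ∀ h y : ℝ, |h| ≤ x →
        ‖g (Circle.exp (y + h)) - g (Circle.exp y)‖ ≤ ω x) → ‖g s - g t‖ < ε := by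
  obtain ⟨x, hxε, hx⟩ := ((ω.tendsto_zero.eventually_lt_const hε).and
    (Ioc_mem_nhdsGT Real.pi_pos)).exists
  have hc : Tendsto (fun s : Circle => Complex.arg ((t⁻¹ * s : Circle) : ℂ)) (𝓝 t) (𝓝 0) := by
    have h1 : ContinuousAt (fun s : Circle => Complex.arg ((t⁻¹ * s : Circle) : ℂ)) t := by
      refine ContinuousAt.comp (g := Complex.arg) (Complex.continuousAt_arg ?_) ?_
      · simp
      · fun_prop
    simpa [ContinuousAt] using h1
  have hs := hc.eventually (Metric.ball_mem_nhds (0 : ℝ) hx.1)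
  filter_upwards [hs] with s hs g hg
  rw [dist_zero_right, Real.norm_eq_abs] at hs
  have h1 := hg x hx (Complex.arg ((t⁻¹ * s : Circle) : ℂ)) (Complex.arg t) hs.le
  rw [Circle.exp_add, Circle.exp_arg, Circle.exp_arg, mul_inv_cancel_left] at h1
  exact h1.trans_lt hxε

/-- By Arzelà–Ascoli it remains to see compactness in the product topology: the constraints are
closed under pointwise limits inside a product of discs, and they force continuity. -/
theorem isCompact_holderBall (ω : BariStechkin) : IsCompact (holderBall ω) := by
  refine ArzelaAscoli.isCompact_of_equicontinuous _ ?_ ?_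
  · have himage : ContinuousMap.toFun '' holderBall ω
        = (Set.univ.pi fun _ : Circle => Metric.closedBall (0 : ℂ) 1) ∩
          {g : Circle → ℂ | ∀ x ∈ Ioc 0 Real.pi, ∀ h y : ℝ, |h| ≤ x →
            ‖g (Circle.exp (y + h)) - g (Circle.exp y)‖ ≤ ω x} := by
      ext g
      constructor
      · rintro ⟨f, hf, rfl⟩
        refine ⟨fun t _ => ?_, fun x hx h y hh => (le_modulusCont f hh y).trans (hf.2 x hx)⟩
        rw [mem_closedBall_zero_iff]
        exact (f.norm_coe_le_norm t).trans hf.1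
      · rintro ⟨h1, h2⟩
        have hc : Continuous g := continuous_iff_continuousAt.mpr fun t =>
          Metric.tendsto_nhds.mpr fun ε hε => by
            filter_upwards [eventually_norm_sub_lt_of_majorant ω t hε] with s hs
            rw [dist_eq_norm]
            exact hs g h2
        refine ⟨⟨g, hc⟩, ⟨(ContinuousMap.norm_le _ zero_le_one).mpr fun t => ?_,
          fun x hx => modulusCont_le (ω.pos x hx).le fun h y hh => h2 x hx h y hh⟩, rfl⟩
        exact mem_closedBall_zero_iff.mp (h1 t (mem_univ t))
    rw [himage]
    refine (isCompact_univ_pi fun _ => isCompact_closedBall _ _).inter_right ?_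
    simp only [ofPred_forall]
    refine isClosed_iInter fun x => isClosed_iInter fun _ => isClosed_iInter fun h =>
      isClosed_iInter fun y => isClosed_iInter fun _ => ?_
    exact isClosed_le (by fun_prop) continuous_const
  · intro t
    refine Metric.equicontinuousAt_iff_right.mpr fun ε hε => ?_
    filter_upwards [eventually_norm_sub_lt_of_majorant ω t hε] with s hs f
    rw [dist_comm, dist_eq_norm]
    exact hs f.1 fun x hx h y hh => (le_modulusCont f.1 hh y).trans (f.2.2 x hx)

theorem isDini_of_mem_holderBall {ω : BariStechkin} {f : C(Circle, ℂ)} (hf : f ∈ holderBall ω) :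
    IsDini f :=
  isDini_of_le ω (ε := 1) (c := 0) fun u hu => by simpa using hf.2 u hu

/-- Dominated convergence: the integrand is at most `2 ω(u)/u`, and for fixed `u` at most `2 ‖f -
f₀‖ / u`. -/
theorem tendsto_diniIntegral_sub {ω : BariStechkin} (f₀ : holderBall ω) :
    Tendsto (fun f : holderBall ω => diniIntegral (f.1 - f₀.1)) (𝓝 f₀) (𝓝 0) := by
  have hpi := Real.pi_pos
  have h0 : ∫ _u in (0 : ℝ)..Real.pi, (0 : ℝ) = 0 := by simp
  rw [← h0]
  refine intervalIntegral.tendsto_integral_filter_of_dominated_convergence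
    (fun u => 2 * (ω u / u)) (Eventually.of_forall fun f =>
      ((measurable_modulusCont _).div measurable_id).aestronglyMeasurable)
    (Eventually.of_forall fun f => Eventually.of_forall fun u hu => ?_)
    (ω.intervalIntegrable_div.const_mul 2) (Eventually.of_forall fun u hu => ?_)
  · rw [uIoc_of_le hpi.le] at hu
    have hu0 := hu.1
    have h1 := modulusCont_add_le f.1 (-f₀.1) u
    rw [modulusCont_neg, ← sub_eq_add_neg] at h1
    have h2 := f.2.2 u hu
    have h3 := f₀.2.2 u hu
    rw [Real.norm_of_nonneg (div_nonneg (modulusCont_nonneg _ _) hu0.le), mul_div_assoc']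
    gcongr
    linarith
  · rw [uIoc_of_le hpi.le] at hu
    have hu0 := hu.1
    have hc : Tendsto (fun f : holderBall ω => 2 * ‖f.1 - f₀.1‖ / u) (𝓝 f₀) (𝓝 0) := by
      have : Continuous fun f : holderBall ω => 2 * ‖f.1 - f₀.1‖ / u := by fun_prop
      simpa using this.tendsto f₀
    refine squeeze_zero (fun f => div_nonneg (modulusCont_nonneg _ _) hu0.le) (fun f => ?_) hc
    gcongr
    exact modulusCont_le_norm _ _

namespace HolderSpace

variable {ω : BariStechkin}

/-- The source carries the uniform topology and the target that of `H^ω`: the integral operator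
gains exactly the strength that compactness requires. -/
theorem continuous_comm (a : HolderSpace ω) :
    Continuous fun f : holderBall ω => comm a f.1 (isDini_of_mem_holderBall f.2) := by
  obtain ⟨K, hK, h⟩ := exists_norm_comm_le ω
  refine continuous_iff_continuousAt.mpr fun f₀ => ?_
  refine tendsto_iff_norm_sub_tendsto_zero.mpr ?_
  have hlim : Tendsto (fun f : holderBall ω =>
      K * ‖a‖ * (‖f.1 - f₀.1‖ + diniIntegral (f.1 - f₀.1))) (𝓝 f₀) (𝓝 0) := by
    have hc : Tendsto (fun f : holderBall ω => ‖f.1 - f₀.1‖) (𝓝 f₀) (𝓝 0) := by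
      have : Continuous fun f : holderBall ω => ‖f.1 - f₀.1‖ := by fun_prop
      simpa using this.tendsto f₀
    simpa using (hc.add (tendsto_diniIntegral_sub f₀)).const_mul (K * ‖a‖)
  refine squeeze_zero (fun f => norm_nonneg _) (fun f => ?_) hlim
  have hf := isDini_of_mem_holderBall f.2
  have hf₀ := isDini_of_mem_holderBall f₀.2
  have e : comm a f.1 hf - comm a f₀.1 hf₀ = comm a (f.1 - f₀.1) (hf.sub hf₀) := by
    ext t
    rw [sub_apply, comm_apply, comm_apply, comm_apply, commIntegral_sub_right a.isDini]
  rw [e]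
  exact h a _ _

theorem isCompactOperator_commutator (a : HolderSpace ω) :
    IsCompactOperator fun f : HolderSpace ω => a * cauchyOp ω f - cauchyOp ω (a * f) := by
  have : CompactSpace (holderBall ω) := isCompact_iff_compactSpace.mp (isCompact_holderBall ω)
  refine ⟨range fun f : holderBall ω =>
    (1 / (Real.pi * Complex.I) : ℂ) • comm a f.1 (isDini_of_mem_holderBall f.2),
    isCompact_range (Continuous.const_smul (continuous_comm a) (1 / (Real.pi * Complex.I) : ℂ)), ?_⟩
  filter_upwards [Metric.ball_mem_nhds (0 : HolderSpace ω) zero_lt_one] with f hf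
  rw [mem_ball_zero_iff, norm_def] at hf
  have h1 := norm_nonneg f.toC
  have h2 := holderSeminorm_nonneg ω f
  refine ⟨⟨f.toC, by linarith, fun x hx => (f.modulusCont_le hx).trans ?_⟩, ?_⟩
  · exact mul_le_of_le_one_left (ω.pos x hx).le (by linarith)
  · exact (commutator_eq a f).symm

end HolderSpace

/-! ### The little Hölder space -/

section LittleHolder

variable {ω : BariStechkin}

theorem mem_littleHolder_iff {f : HolderSpace ω} :
    f ∈ littleHolder ω ↔ Tendsto (fun x => modulusCont f x / ω x) (𝓝[>] 0) (𝓝 0) := Iff.rfl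

theorem mem_littleHolder_of_eventually {f : HolderSpace ω}
    (h : ∀ δ > 0, ∀ᶠ x in 𝓝[>] (0 : ℝ), modulusCont f x / ω x < δ) : f ∈ littleHolder ω := by
  refine Metric.tendsto_nhds.mpr fun δ hδ => ?_
  filter_upwards [h δ hδ, Ioc_mem_nhdsGT Real.pi_pos] with x hx hx'
  rwa [dist_zero_right, Real.norm_of_nonneg (div_nonneg (modulusCont_nonneg _ _) (ω.pos x hx').le)]

theorem littleHolder_isUnit_iff (a : littleHolder ω) :
    IsUnit a ↔ ∀ t : Circle, (a : HolderSpace ω) t ≠ 0 := by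
  constructor
  · intro ha
    exact HolderSpace.apply_ne_zero_of_isUnit (ha.map (littleHolder ω).val)
  · intro ha
    obtain ⟨g, hg, C, hC, hm⟩ := (a : HolderSpace ω).exists_inverse ha
    have hlim : Tendsto (fun x => C * (modulusCont (a : HolderSpace ω) x / ω x)) (𝓝[>] 0) (𝓝 0) := by
      simpa using Tendsto.const_mul C (mem_littleHolder_iff.mp a.2)
    have hmem : g ∈ littleHolder ω := by
      refine squeeze_zero' ?_ ?_ hlim
      · filter_upwards [Ioc_mem_nhdsGT Real.pi_pos] with x hx
        exact div_nonneg (modulusCont_nonneg _ _) (ω.pos x hx).le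
      · filter_upwards [Ioc_mem_nhdsGT Real.pi_pos] with x hx
        rw [mul_div_assoc']
        exact div_le_div_of_nonneg_right (hm x) (ω.pos x hx).le
    exact IsUnit.of_mul_eq_one (⟨g, hmem⟩ : littleHolder ω) (Subtype.ext hg)

/-- Below some `η` the quotient is less than `ε`; above it the trivial bound `2‖f‖` is at most `2‖f‖
u²/η²`. -/
theorem exists_modulusCont_le_of_mem_littleHolder {f : HolderSpace ω} (hf : f ∈ littleHolder ω)
    {ε : ℝ} (hε : 0 < ε) : ∃ c : ℝ, 0 ≤ c ∧
      ∀ u ∈ Ioc 0 Real.pi, modulusCont f u ≤ ε * ω u + c * u ^ 2 := by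
  obtain ⟨η, hη, hη'⟩ := mem_nhdsGT_iff_exists_Ioo_subset.mp
    ((mem_littleHolder_iff.mp hf).eventually_lt_const hε)
  have hη0 : 0 < η := hη
  refine ⟨2 * ‖f.toC‖ / η ^ 2, by positivity, fun u hu => ?_⟩
  have hω := ω.pos u hu
  rcases lt_or_ge u η with h | h
  · have h1 : modulusCont f u / ω u < ε := hη' ⟨hu.1, h⟩
    rw [div_lt_iff₀ hω] at h1
    have : 0 ≤ 2 * ‖f.toC‖ / η ^ 2 * u ^ 2 := by positivity
    linarith
  · have h1 := modulusCont_le_norm f.toC u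
    have h2 : 2 * ‖f.toC‖ ≤ 2 * ‖f.toC‖ / η ^ 2 * u ^ 2 := by
      rw [div_mul_eq_mul_div, le_div_iff₀ (by positivity)]
      gcongr
    have : 0 ≤ ε * ω u := by positivity
    linarith

/-- After division by `ω(x)` the majorant `ε ω + c u²` leaves a multiple of `ε` plus a multiple of
`x/ω(x)`, which tends to zero. -/
theorem comm_mem_littleHolder {a : HolderSpace ω} (ha : a ∈ littleHolder ω) (f : C(Circle, ℂ))
    (hf : IsDini f) : HolderSpace.comm a f hf ∈ littleHolder ω := by
  have hpi := Real.pi_pos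
  obtain ⟨K, hK, h⟩ := exists_modulusCont_commIntegral_le_of_small ω
  obtain ⟨A, hA, hinc⟩ := ω.exists_almostIncreasing
  have hd := diniIntegral_nonneg f
  set L := K * (‖f‖ + diniIntegral f) with hL
  have hL0 : 0 ≤ L := by positivity
  refine mem_littleHolder_of_eventually fun δ hδ => ?_
  -- The summand `1` in the denominator covers `L = 0`.
  obtain ⟨ε, hε, hεδ⟩ : ∃ ε : ℝ, 0 < ε ∧ L * ε * A < δ / 2 := by
    refine ⟨δ / 2 / (L * A + 1), by positivity, ?_⟩
    rw [mul_div_assoc', div_mul_eq_mul_div, div_lt_iff₀ (by positivity)]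
    linarith
  obtain ⟨c, hc, hm⟩ := exists_modulusCont_le_of_mem_littleHolder ha hε
  have hlim : Tendsto (fun x => L * c * (x / ω x)) (𝓝[>] 0) (𝓝 0) := by
    simpa using ω.tendsto_div_self.const_mul (L * c)
  have hI : Ioc 0 (Real.pi / 3) ∈ 𝓝[>] (0 : ℝ) := Ioc_mem_nhdsGT (by positivity)
  filter_upwards [hI, hlim.eventually_lt_const (half_pos hδ)] with x hx hx2
  have hxm : x ∈ Ioc 0 Real.pi := ⟨hx.1, by linarith [hx.2]⟩
  have hω := ω.pos x hxm
  have hx0 := hx.1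
  have hb : modulusCont (HolderSpace.comm a f hf) x ≤ L * (ε * (A * ω x) + c * x) := by
    refine modulusCont_le_of_pos (by positivity) fun r y hr hrx => ?_
    refine (h a.toC f ε c hε.le hc hf hm r y hr (hrx.trans hx.2)).trans ?_
    have := hinc r x hr hrx hxm.2
    gcongr
  calc _ ≤ L * (ε * (A * ω x) + c * x) / ω x := by gcongr
    _ = L * ε * A + L * c * (x / ω x) := by field_simp
    _ < δ := by linarith

theorem cauchyOp_mem_littleHolder {f : HolderSpace ω} (hf : f ∈ littleHolder ω) :
    HolderSpace.cauchyOp ω f ∈ littleHolder ω :=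
  sub_mem hf ((littleHolder ω).smul_mem (comm_mem_littleHolder hf 1 isDini_one) _)

/-- The seminorm bounds the quotients uniformly in `x`, so their vanishing at `0` survives limits in
norm. Closedness lets a compact subset of `H^ω` pull back to a compact subset of `H_0^ω`. -/
theorem isClosed_littleHolder (ω : BariStechkin) :
    IsClosed (littleHolder ω : Set (HolderSpace ω)) := by
  refine isClosed_of_closure_subset fun f hf => ?_
  refine mem_littleHolder_of_eventually fun δ hδ => ?_
  obtain ⟨g, hg, hfg⟩ := Metric.mem_closure_iff.mp hf (δ / 2) (half_pos hδ)
  rw [dist_eq_norm, HolderSpace.norm_def] at hfg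
  filter_upwards [(mem_littleHolder_iff.mp hg).eventually_lt_const (half_pos hδ),
    Ioc_mem_nhdsGT Real.pi_pos] with x hx hxm
  have h1 := quotient_add_le ω (f - g).toC g.toC hxm
  have e : (f - g).toC + g.toC = f.toC := sub_add_cancel f.toC g.toC
  rw [e] at h1
  have h2 := le_holderSeminorm (f - g).bdd hxm
  have h3 := norm_nonneg (f - g).toC
  linarith

/-- The Cauchy singular integral operator on `H_0^ω`. -/
noncomputable def littleCauchyOp (ω : BariStechkin) : littleHolder ω →L[ℂ] littleHolder ω where
  toFun f := ⟨HolderSpace.cauchyOp ω f, cauchyOp_mem_littleHolder f.2⟩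
  map_add' f g := Subtype.ext (map_add (HolderSpace.cauchyOp ω) (f : HolderSpace ω) g)
  map_smul' c f := Subtype.ext (map_smul (HolderSpace.cauchyOp ω) c (f : HolderSpace ω))
  cont := ((HolderSpace.cauchyOp ω).continuous.comp continuous_subtype_val).subtype_mk _

theorem isCompactOperator_littleCommutator (a : littleHolder ω) :
    IsCompactOperator fun f : littleHolder ω =>
      a * littleCauchyOp ω f - littleCauchyOp ω (a * f) := by
  obtain ⟨K, hK, hmem⟩ := HolderSpace.isCompactOperator_commutator (a : HolderSpace ω)
  refine ⟨((↑) : littleHolder ω → HolderSpace ω) ⁻¹' K,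
    (isClosed_littleHolder ω).isClosedEmbedding_subtypeVal.isCompact_preimage hK, ?_⟩
  exact (continuous_subtype_val.tendsto (0 : littleHolder ω)).eventually hmem

end LittleHolder

theorem theorem3p3 (ω : BariStechkin) :
    ((∀ a : HolderSpace ω, IsUnit a ↔ ∀ t : Circle, a t ≠ 0) ∧
      ∃ S : HolderSpace ω →L[ℂ] HolderSpace ω,
        (∀ f : HolderSpace ω, IsCauchySingularIntegral f (S f)) ∧
        ∀ a : HolderSpace ω, IsCompactOperator fun f : HolderSpace ω => a * S f - S (a * f)) ∧
    ((∀ a : littleHolder ω, IsUnit a ↔ ∀ t : Circle, (a : HolderSpace ω) t ≠ 0) ∧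
      ∃ S : littleHolder ω →L[ℂ] littleHolder ω,
        (∀ f : littleHolder ω,
          IsCauchySingularIntegral (f : HolderSpace ω) (S f : HolderSpace ω)) ∧
        ∀ a : littleHolder ω,
          IsCompactOperator fun f : littleHolder ω => a * S f - S (a * f)) :=
  ⟨⟨HolderSpace.isUnit_iff, HolderSpace.cauchyOp ω,
      HolderSpace.isCauchySingularIntegral_cauchyOp, HolderSpace.isCompactOperator_commutator⟩,
    ⟨littleHolder_isUnit_iff, littleCauchyOp ω,
      fun f => HolderSpace.isCauchySingularIntegral_cauchyOp (f : HolderSpace ω),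
      isCompactOperator_littleCommutator⟩⟩
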